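/- Let $N\ge 2$, let $\omega\subset\mathbb{R}^{N-1}$ be a bounded domain with smooth boundary, and let $\mathcal{C}_\omega=\omega\times(0,+\infty)\subset\mathbb{R}^N$ with lateral boundary $\partial\mathcal{C}_\omega^+=\partial\mathcal{C}_\omega\cap\{x_N>0\}$. Let $\varphi\in C^2(\overline{\omega})$ (that is, $\varphi$ is $C^2$ in $\omega$, continuous on $\overline\omega$, and its derivatives of order at most $2$ extend continuously to $\overline{\omega}$) with $\varphi>0$ on $\overline{\omega}$. Put $$\Gamma_\varphi=\{(x',x_N)\in\mathbb{R}^N: x'\in\omega,\ x_N=\varphi(x')\},\qquad \Omega_\varphi=\{(x',x_N)\in\mathbb{R}^N: x'\in\omega,\ 0<x_N<\varphi(x')\}.$$ Let $\nu$ be the unit normal to $\Gamma_\varphi$ exterior to $\Omega_\varphi$, extended by continuity to $\overline{\Gamma_\varphi}$. Let $H_{\Gamma_\varphi}$ be the mean curvature of $\Gamma_\varphi$ with respect to $\nu$, that is, the mean of the $N-1$ principal curvatures, with the sign for which spheres have positive mean curvature with respect to their exterior normal. Let $d\sigma$ be the $(N-1)$-dimensional surface measure (the $(N-1)$-dimensional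 Hausdorff measure, normalized to agree with Lebesgue measure on $\mathbb{R}^{N-1}$), and let $e_N=(0,\dots,0,1)$. Assume that $\Gamma_\varphi$ meets $\partial\mathcal{C}_\omega^+$ orthogonally: $\langle\nu(x),\nu_{\partial\mathcal{C}_\omega^+}(x)\rangle=0$ for every $x\in\overline{\Gamma_\varphi}\cap\partial\mathcal{C}_\omega^+$, where $\nu_{\partial\mathcal{C}_\omega^+}$ is the outer unit normal to $\mathcal{C}_\omega$ on $\partial\mathcal{C}_\omega^+$. Then both integrals below converge absolutely and $$\int_{\Gamma_\varphi} H_{\Gamma_\varphi}\,\langle x_N e_N,\nu\rangle\,d\sigma=\frac{1}{N-1}\int_\omega\frac{|\nabla\varphi|^2}{\sqrt{1+|\nabla\varphi|^2}}\,dx'.$$ -/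

import Mathlib

open Set Filter Topology MeasureTheory
open scoped RealInnerProductSpace

noncomputable section

namespace CylinderGraph

/-! ### Domains, boundaries and outer unit normals -/

section General

variable {E : Type*} [NormedAddCommGroup E] [InnerProductSpace ℝ E] [CompleteSpace E]

/-- `g` is a `C^k` local defining function of the set `D` near the boundary point `p`:
on some open neighbourhood `U` of `p` it is of class `C^k`, `D ∩ U = {x ∈ U | g x < 0}`, `g p = 0`
and `∇g(p) ≠ 0`. -/
def IsLocalDefiningFunction (k : ℕ∞) (D : Set E) (p : E) (g : E → ℝ) : Prop :=
  ∃ U : Set E, IsOpen U ∧ p ∈ U ∧ ContDiffOn ℝ k g U ∧ (∀ x ∈ U, x ∈ D ↔ g x < 0) ∧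
    g p = 0 ∧ gradient g p ≠ 0

/-- A smooth bounded domain: open, connected (hence nonempty), bounded, and near each point of its
boundary it lies on one side of a smooth hypersurface. -/
structure IsSmoothBoundedDomain (ω : Set E) : Prop where
  isOpen : IsOpen ω
  isConnected : IsConnected ω
  isBounded : Bornology.IsBounded ω
  smooth_boundary : ∀ p ∈ frontier ω, ∃ g : E → ℝ, IsLocalDefiningFunction (⊤ : ℕ∞) ω p g

/-- The class `C^k` up to the boundary of the open set `ω`: `f` is `C^k` in `ω`, continuous on
`closure ω`, and all its derivatives of order at most `k` extend continuously from `ω` to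
`closure ω`. -/
def ContDiffUpToBoundary (k : ℕ) (f : E → ℝ) (ω : Set E) : Prop :=
  ContDiffOn ℝ k f ω ∧ ContinuousOn f (closure ω) ∧
    ∀ j : ℕ, j ≤ k → ∃ T : E → ContinuousMultilinearMap ℝ (fun _ : Fin j => E) ℝ,
      ContinuousOn T (closure ω) ∧ EqOn T (iteratedFDeriv ℝ j f) ω

/-- `ν` is the outer unit normal to `D` at the `C^1` boundary point `p`: `ν = ∇g(p) / |∇g(p)|` for
a `C^1` local defining function `g` of `D` near `p`. -/
def IsOuterUnitNormal (D : Set E) (p ν : E) : Prop :=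
  ∃ g : E → ℝ, IsLocalDefiningFunction 1 D p g ∧ ν = ‖gradient g p‖⁻¹ • gradient g p

theorem IsOuterUnitNormal.norm_eq {D : Set E} {p ν : E} (h : IsOuterUnitNormal D p ν) :
    ‖ν‖ = 1 := by
  obtain ⟨g, ⟨U, -, -, -, -, -, hg⟩, rfl⟩ := h
  rw [norm_smul, norm_inv, norm_norm]
  exact inv_mul_cancel₀ (norm_ne_zero_iff.2 hg)

theorem IsOuterUnitNormal.exists_deriv {D : Set E} {p ν : E} (h : IsOuterUnitNormal D p ν) (v : E) :
    ∃ (f : ℝ → ℝ) (c : ℝ), 0 < c ∧ f 0 = 0 ∧ HasDerivAt f (c * ⟪ν, v⟫) 0 ∧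
      ∀ᶠ t in 𝓝 (0 : ℝ), p + t • v ∈ D ↔ f t < 0 := by
  obtain ⟨g, ⟨U, hU, hp, hC, hD, h0, hg⟩, rfl⟩ := h
  have hd : DifferentiableAt ℝ g p :=
    (hC.contDiffAt (hU.mem_nhds hp)).differentiableAt (by simp)
  have hl : HasDerivAt (fun t : ℝ => p + t • v) v 0 := by
    simpa using ((hasDerivAt_id (0 : ℝ)).smul_const v).const_add p
  have hgr : HasFDerivAt g (InnerProductSpace.toDual ℝ E (gradient g p)) (p + (0 : ℝ) • v) := by
    simpa using hd.hasGradientAt.hasFDerivAt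
  refine ⟨fun t => g (p + t • v), ‖gradient g p‖, norm_pos_iff.2 hg, by simpa using h0, ?_, ?_⟩
  · have := hgr.comp_hasDerivAt (0 : ℝ) hl
    rw [InnerProductSpace.toDual_apply_apply] at this
    rw [inner_smul_left, ← mul_assoc]
    have hc : ‖gradient g p‖ * (starRingEnd ℝ) ‖gradient g p‖⁻¹ = 1 :=
      mul_inv_cancel₀ (norm_ne_zero_iff.2 hg)
    rw [hc, one_mul]
    exact this
  · have hc : Tendsto (fun t : ℝ => p + t • v) (𝓝 0) (𝓝 p) := by
      simpa using hl.continuousAt.tendsto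
    filter_upwards [hc (hU.mem_nhds hp)] with t ht using hD _ ht

/-- The outer unit normal is unique. -/
theorem IsOuterUnitNormal.eq {D : Set E} {p ν μ : E} (h : IsOuterUnitNormal D p ν)
    (h' : IsOuterUnitNormal D p μ) : ν = μ := by
  by_contra hne
  have hν := h.norm_eq
  have hμ := h'.norm_eq
  have hlt : ⟪ν, μ⟫ < 1 := (inner_lt_one_iff_real_of_norm_eq_one hν hμ).2 hne
  obtain ⟨f, c, hc, f0, hf, hfD⟩ := h.exists_deriv (μ - ν)
  obtain ⟨k, d, hd, k0, hk, hkD⟩ := h'.exists_deriv (μ - ν)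
  have e1 : c * ⟪ν, μ - ν⟫ < 0 := by
    rw [inner_sub_right, real_inner_self_eq_norm_sq, hν]
    exact mul_neg_of_pos_of_neg hc (by linarith)
  have e2 : 0 < d * ⟪μ, μ - ν⟫ := by
    rw [inner_sub_right, real_inner_self_eq_norm_sq, hμ, real_inner_comm]
    exact mul_pos hd (by linarith)
  have s1 := (hasDerivAt_iff_tendsto_slope.1 hf).eventually (gt_mem_nhds e1)
  have s2 := (hasDerivAt_iff_tendsto_slope.1 hk).eventually (lt_mem_nhds e2)
  have hle : 𝓝[>] (0 : ℝ) ≤ 𝓝[≠] 0 := nhdsWithin_mono _ fun x hx => ne_of_gt hx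
  have hle' : 𝓝[>] (0 : ℝ) ≤ 𝓝 0 := nhdsWithin_le_nhds
  obtain ⟨t, ⟨⟨⟨⟨a1, a2⟩, a3⟩, a4⟩, a5⟩⟩ := ((((s1.filter_mono hle).and (s2.filter_mono hle)).and
    (hfD.filter_mono hle')).and (hkD.filter_mono hle')).and self_mem_nhdsWithin |>.exists
  have ht : (0 : ℝ) < t := a5
  simp only [slope_def_field, f0, k0, sub_zero] at a1 a2
  have b1 : f t < 0 := by
    by_contra hn
    exact absurd a1 (not_lt.2 (div_nonneg (not_lt.1 hn) ht.le))
  have b2 : 0 < k t := by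
    by_contra hn
    exact absurd a2 (not_lt.2 (div_nonpos_of_nonpos_of_nonneg (not_lt.1 hn) ht.le))
  exact absurd (a4.1 (a3.2 b1)) (not_lt.2 b2.le)

/-- The outer unit normal to `D` at `p`. It is a junk value if `p` is not a `C^1` boundary point;
otherwise it is the only vector as in `IsOuterUnitNormal`. -/
def outerUnitNormal (D : Set E) (p : E) : E :=
  Classical.epsilon (IsOuterUnitNormal D p)

theorem outerUnitNormal_eq {D : Set E} {p ν : E} (h : IsOuterUnitNormal D p ν) :
    outerUnitNormal D p = ν :=
  (Classical.epsilon_spec (p := IsOuterUnitNormal D p) ⟨ν, h⟩).eq h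

end General

/-! ### Mean curvature of a parametrized hypersurface -/

/-- The partial derivative `∂ᵢ F` of a map defined on `ℝⁿ`. -/
def partialDeriv {n : ℕ} {V : Type*} [NormedAddCommGroup V] [NormedSpace ℝ V]
    (i : Fin n) (F : EuclideanSpace ℝ (Fin n) → V) (y : EuclideanSpace ℝ (Fin n)) : V :=
  fderiv ℝ F y (EuclideanSpace.single i 1)

variable {n : ℕ}

/-- First fundamental form `⟨∂ᵢF, ∂ⱼF⟩` of the parametrized hypersurface `F` at parameter `y`. -/
def firstFundamentalForm
    (F : EuclideanSpace ℝ (Fin n) → EuclideanSpace ℝ (Fin (n + 1)))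
    (y : EuclideanSpace ℝ (Fin n)) : Matrix (Fin n) (Fin n) ℝ :=
  Matrix.of fun i j => ⟪partialDeriv i F y, partialDeriv j F y⟫

/-- Second fundamental form `-⟨∂ᵢ∂ⱼF, ν⟩` of the parametrized hypersurface `F` at parameter `y`,
with respect to the unit normal `ν` at `F y`. With this sign it equals `⟨∂ᵢν, ∂ⱼF⟩`, and it is
positive definite for a sphere and its exterior normal. -/
def secondFundamentalForm
    (F : EuclideanSpace ℝ (Fin n) → EuclideanSpace ℝ (Fin (n + 1)))
    (ν : EuclideanSpace ℝ (Fin (n + 1))) (y : EuclideanSpace ℝ (Fin n)) :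
    Matrix (Fin n) (Fin n) ℝ :=
  Matrix.of fun i j => -⟪partialDeriv i (partialDeriv j F) y, ν⟫

/-- Mean curvature: the mean of the principal curvatures, that is, `1/n` times the trace of the
second fundamental form with respect to the first. -/
def meanCurvature
    (F : EuclideanSpace ℝ (Fin n) → EuclideanSpace ℝ (Fin (n + 1)))
    (ν : EuclideanSpace ℝ (Fin (n + 1))) (y : EuclideanSpace ℝ (Fin n)) : ℝ :=
  (1 / (n : ℝ)) * ((firstFundamentalForm F y)⁻¹ * secondFundamentalForm F ν y).trace

/-! ### Graphs in the cylinder; here `N = n + 1` -/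

/-- The horizontal part `x'` of `x = (x', x_N)`. -/
def base (x : EuclideanSpace ℝ (Fin (n + 1))) : EuclideanSpace ℝ (Fin n) :=
  WithLp.toLp 2 fun i => x i.castSucc

/-- The last coordinate `x_N` of `x = (x', x_N)`. -/
def height (x : EuclideanSpace ℝ (Fin (n + 1))) : ℝ := x (Fin.last n)

/-- The vector `e_N = (0, …, 0, 1)`. -/
def eLast : EuclideanSpace ℝ (Fin (n + 1)) := EuclideanSpace.single (Fin.last n) 1

/-- The map `x' ↦ (x', φ x')`. -/
def graphMap (φ : EuclideanSpace ℝ (Fin n) → ℝ) (y : EuclideanSpace ℝ (Fin n)) :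
    EuclideanSpace ℝ (Fin (n + 1)) :=
  WithLp.toLp 2 (Fin.snoc (α := fun _ => ℝ) (fun i => y i) (φ y))

/-- The half-cylinder `ω × (0, ∞)`. -/
def cylinder (ω : Set (EuclideanSpace ℝ (Fin n))) : Set (EuclideanSpace ℝ (Fin (n + 1))) :=
  {x | base x ∈ ω ∧ 0 < height x}

/-- The lateral part of the boundary of the half-cylinder. -/
def lateralBoundary (ω : Set (EuclideanSpace ℝ (Fin n))) :
    Set (EuclideanSpace ℝ (Fin (n + 1))) :=
  frontier (cylinder ω) ∩ {x | 0 < height x}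

/-- The cartesian graph `Γ_φ` over `ω`. -/
def graph (ω : Set (EuclideanSpace ℝ (Fin n))) (φ : EuclideanSpace ℝ (Fin n) → ℝ) :
    Set (EuclideanSpace ℝ (Fin (n + 1))) :=
  {x | base x ∈ ω ∧ height x = φ (base x)}

/-- The part `Ω_φ` of the half-cylinder below the graph. -/
def subgraph (ω : Set (EuclideanSpace ℝ (Fin n))) (φ : EuclideanSpace ℝ (Fin n) → ℝ) :
    Set (EuclideanSpace ℝ (Fin (n + 1))) :=
  {x | x ∈ cylinder ω ∧ height x < φ (base x)}

/-- The unit normal field of `Γ_φ` exterior to `Ω_φ`, extended by continuity to the closure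
of `Γ_φ`. -/
def graphNormal (ω : Set (EuclideanSpace ℝ (Fin n))) (φ : EuclideanSpace ℝ (Fin n) → ℝ) :
    EuclideanSpace ℝ (Fin (n + 1)) → EuclideanSpace ℝ (Fin (n + 1)) :=
  extendFrom (graph ω φ) (outerUnitNormal (subgraph ω φ))

/-- The mean curvature of `Γ_φ` at its point `x`, with respect to the exterior unit normal. -/
def graphMeanCurvature (ω : Set (EuclideanSpace ℝ (Fin n))) (φ : EuclideanSpace ℝ (Fin n) → ℝ)
    (x : EuclideanSpace ℝ (Fin (n + 1))) : ℝ :=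
  meanCurvature (graphMap φ) (graphNormal ω φ x) (base x)

/-- `Γ_φ` meets the lateral boundary of the cylinder orthogonally: at the common points of that
boundary and of the closure of `Γ_φ` the two normals are orthogonal. -/
def MeetsOrthogonally (ω : Set (EuclideanSpace ℝ (Fin n))) (φ : EuclideanSpace ℝ (Fin n) → ℝ) :
    Prop :=
  ∀ x ∈ closure (graph ω φ) ∩ lateralBoundary ω,
    ⟪graphNormal ω φ x, outerUnitNormal (cylinder ω) x⟫ = 0

end CylinderGraph

end

/-! Write `n = N - 1` and `W = √(1 + |∇φ|²)`. Over `ω` the exterior normal is `(-∇φ, 1) / W`, so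
`⟨x_N e_N, ν⟩ = φ / W`; the surface measure is `W dx'`; and `n H = -div(∇φ / W)`. The factors `W`
cancel and the left-hand side is `-(1/n) ∫ φ div(∇φ / W)`. Integration by parts turns this into
`(1/n) ∫ |∇φ|² / W`. The boundary term vanishes: the normal of the cylinder is horizontal, so
orthogonality says exactly that `∇φ` is tangential to `∂ω`.

Three ingredients carry this. The curvature formula is `meanCurvature_graphMap` combined with
`divergence_inv_sqrt_smul`. The surface measure is `map_base_restrict_graph`: near a point the graph
map is almost isometric, up to a factor `1 + δ`, to a linear map of determinant `W`. The integration
by parts is `IsSmoothBoundedDomain.setIntegral_divergence_eq_zero`, fed by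
`MeetsOrthogonally.inner_gradient_eq_zero`.

As only tangential fields occur, no boundary integral is needed. The field is cut off in a layer of
width about `1/k` along the boundary; the error is the flux through that layer, where the normal
component tends uniformly to zero while the total weight of the layer stays bounded.

Regularity up to the boundary enters through continuous extensions `G`, `H` of the gradient and the
Hessian, since the derivatives of `φ` at points of `∂ω` carry no information. -/

noncomputable section

namespace CylinderGraph

/-! ### The divergence theorem for tangential vector fields -/

section Divergence

variable {n : ℕ}

/-- The divergence of a vector field on `ℝⁿ`. -/
def divergence (V : EuclideanSpace ℝ (Fin n) → EuclideanSpace ℝ (Fin n))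
    (y : EuclideanSpace ℝ (Fin n)) : ℝ :=
  ∑ i, partialDeriv i V y i

theorem euclidean_sum_smul_single (v : EuclideanSpace ℝ (Fin n)) :
    ∑ i, v i • EuclideanSpace.single i (1 : ℝ) = v := by
  simpa using (EuclideanSpace.basisFun (Fin n) ℝ).sum_repr v

theorem divergence_smul {a : EuclideanSpace ℝ (Fin n) → ℝ}
    {V : EuclideanSpace ℝ (Fin n) → EuclideanSpace ℝ (Fin n)} {y : EuclideanSpace ℝ (Fin n)}
    (ha : DifferentiableAt ℝ a y) (hV : DifferentiableAt ℝ V y) :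
    divergence (fun x => a x • V x) y = a y * divergence V y + fderiv ℝ a y (V y) := by
  have h : fderiv ℝ (fun x => a x • V x) y =
      a y • fderiv ℝ V y + (fderiv ℝ a y).smulRight (V y) := fderiv_fun_smul ha hV
  simp only [divergence, partialDeriv, h]
  conv_rhs => rw [← euclidean_sum_smul_single (V y), map_sum]
  simp [Finset.sum_add_distrib, Finset.mul_sum, mul_comm]

theorem continuous_divergence {V : EuclideanSpace ℝ (Fin n) → EuclideanSpace ℝ (Fin n)}
    (hV : ContDiff ℝ 1 V) : Continuous (divergence V) := by
  have h := hV.continuous_fderiv one_ne_zero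
  unfold divergence partialDeriv
  fun_prop

theorem divergence_eq_zero_of_notMem_tsupport
    {V : EuclideanSpace ℝ (Fin n) → EuclideanSpace ℝ (Fin n)} {y : EuclideanSpace ℝ (Fin n)}
    (hy : y ∉ tsupport V) : divergence V y = 0 := by
  have h : fderiv ℝ V y = 0 := by
    by_contra h
    exact hy (support_fderiv_subset ℝ h)
  simp [divergence, partialDeriv, h]

theorem continuousOn_divergence {V : EuclideanSpace ℝ (Fin n) → EuclideanSpace ℝ (Fin n)}
    {ω : Set (EuclideanSpace ℝ (Fin n))} (hω : IsOpen ω)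
    (hV : ContDiffOn ℝ 1 V ω) : ContinuousOn (divergence V) ω := by
  have h := hV.continuousOn_fderiv_of_isOpen hω le_rfl
  unfold divergence partialDeriv
  fun_prop

theorem integral_fderiv_apply_eq_zero {f : EuclideanSpace ℝ (Fin n) → ℝ} (hf : ContDiff ℝ 1 f)
    (hc : HasCompactSupport f) (v : EuclideanSpace ℝ (Fin n)) :
    ∫ x, fderiv ℝ f x v = 0 := by
  have hi : Integrable (fun x => fderiv ℝ f x v) :=
    ((hf.continuous_fderiv one_ne_zero).clm_apply continuous_const).integrable_of_hasCompactSupport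
      (hc.fderiv_apply ℝ v)
  have h := integral_mul_fderiv_eq_neg_fderiv_mul_of_integrable (μ := volume)
    (f := fun _ : EuclideanSpace ℝ (Fin n) => (1 : ℝ)) (g := f) (v := v)
    (by simp) (by simpa using hi)
    (by simpa using hf.continuous.integrable_of_hasCompactSupport hc)
    (fun x _ => differentiableAt_const _) (fun x _ => hf.differentiable one_ne_zero x)
  simpa using h

theorem integral_divergence_eq_zero_of_hasCompactSupport
    {V : EuclideanSpace ℝ (Fin n) → EuclideanSpace ℝ (Fin n)} (hV : ContDiff ℝ 1 V)
    (hc : HasCompactSupport V) : ∫ x, divergence V x = 0 := by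
  have hV' : ∀ i, ContDiff ℝ 1 fun x => V x i := fun i => by fun_prop
  have hc' : ∀ i, HasCompactSupport fun x => V x i := fun i =>
    hc.comp_left (g := fun v : EuclideanSpace ℝ (Fin n) => v i) rfl
  have e : ∀ i x, partialDeriv i V x i =
      fderiv ℝ (fun x => V x i) x (EuclideanSpace.single i 1) := fun i x => by
    have h1 := (hV.differentiable one_ne_zero x).hasFDerivAt
    have h2 := ((EuclideanSpace.proj (𝕜 := ℝ) i).hasFDerivAt (x := V x)).comp x h1
    exact congrArg (fun L : _ →L[ℝ] ℝ => L (EuclideanSpace.single i 1)) h2.fderiv.symm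
  simp only [divergence, e]
  rw [integral_finsetSum]
  · exact Finset.sum_eq_zero fun i _ => integral_fderiv_apply_eq_zero (hV' i) (hc' i) _
  · exact fun i _ => (((hV' i).continuous_fderiv one_ne_zero).clm_apply
      continuous_const).integrable_of_hasCompactSupport ((hc' i).fderiv_apply ℝ _)

end Divergence

/-! ### Vanishing flux near a boundary point, by cutoffs. -/

section BoundaryLocalization

variable {n : ℕ}

theorem contDiff_of_forall_mem_tsupport {F : Type*} [NormedAddCommGroup F] [NormedSpace ℝ F]
    {k : WithTop ℕ∞} {f : EuclideanSpace ℝ (Fin n) → F}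
    (hf : ∀ x ∈ tsupport f, ContDiffAt ℝ k f x) : ContDiff ℝ k f := by
  refine contDiff_iff_contDiffAt.2 fun x => ?_
  by_cases hx : x ∈ tsupport f
  · exact hf x hx
  · exact contDiffAt_const.congr_of_eventuallyEq (notMem_tsupport_iff_eventuallyEq.1 hx)

theorem deriv_smoothTransition_nonneg (t : ℝ) : 0 ≤ deriv Real.smoothTransition t :=
  Real.smoothTransition.monotone.deriv_nonneg

theorem deriv_smoothTransition_of_one_lt {t : ℝ} (ht : 1 < t) :
    deriv Real.smoothTransition t = 0 := by
  have h : Real.smoothTransition =ᶠ[𝓝 t] fun _ => (1 : ℝ) := by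
    filter_upwards [lt_mem_nhds ht] with s hs using Real.smoothTransition.one_of_one_le hs.le
  rw [h.deriv_eq, deriv_const]

/-- A localized vector field that is tangential along the boundary has vanishing total
divergence. -/
theorem setIntegral_divergence_smul_eq_zero_of_tangential
    {ω : Set (EuclideanSpace ℝ (Fin n))} (hω : IsOpen ω) (hωb : Bornology.IsBounded ω)
    {V : EuclideanSpace ℝ (Fin n) → EuclideanSpace ℝ (Fin n)} (hVc : ContinuousOn V (closure ω))
    (hV : ContDiffOn ℝ 1 V ω) (hdiv : IntegrableOn (divergence V) ω)
    {U : Set (EuclideanSpace ℝ (Fin n))} (hU : IsOpen U) {g : EuclideanSpace ℝ (Fin n) → ℝ}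
    (hg : ContDiffOn ℝ 1 g U) (hgω : ∀ x ∈ U, x ∈ ω ↔ g x < 0)
    (htan : ∀ x ∈ U ∩ frontier ω, fderiv ℝ g x (V x) = 0)
    {e : EuclideanSpace ℝ (Fin n)} {c : ℝ} (hc : 0 < c) (hge : ∀ x ∈ U, c ≤ fderiv ℝ g x e)
    {ρ : EuclideanSpace ℝ (Fin n) → ℝ} (hρ : ContDiff ℝ 1 ρ) (hρc : HasCompactSupport ρ)
    (hρU : tsupport ρ ⊆ U) (hρ0 : ∀ x, 0 ≤ ρ x) :
    ∫ x in ω, divergence (fun y => ρ y • V y) x = 0 := by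
  set A := ω ∩ U with hA
  have hAo : IsOpen A := hω.inter hU
  have hAm : MeasurableSet A := hAo.measurableSet
  set P := divergence (fun y => ρ y • V y) with hP
  have hPA : ∫ x in ω, P x = ∫ x in A, P x := by
    have h0 : ∀ x ∈ ω \ A, P x = 0 := fun x hx =>
      divergence_eq_zero_of_notMem_tsupport fun h => hx.2 ⟨hx.1, hρU
        (tsupport_smul_subset_left ρ V h)⟩
    exact setIntegral_eq_of_subset_of_forall_sdiff_eq_zero hω.measurableSet inter_subset_left h0
  have hgd : ∀ x ∈ U, HasFDerivAt g (fderiv ℝ g x) x := fun x hx =>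
    ((hg.contDiffAt (hU.mem_nhds hx)).differentiableAt one_ne_zero).hasFDerivAt
  have hgc : ContinuousOn (fderiv ℝ g) U := hg.continuousOn_fderiv_of_isOpen hU le_rfl
  have hVd : ∀ x ∈ ω, DifferentiableAt ℝ V x := fun x hx =>
    (hV.contDiffAt (hω.mem_nhds hx)).differentiableAt one_ne_zero
  have hρd : ∀ x, HasFDerivAt ρ (fderiv ℝ ρ x) x := fun x =>
    (hρ.differentiable one_ne_zero x).hasFDerivAt
  have hρ' : Continuous (fderiv ℝ ρ) := hρ.continuous_fderiv one_ne_zero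
  -- The cutoff is `0` where `-k g ≤ 1` and `1` where `-k g ≥ 2`. The shift by `1` keeps its support
  -- off the boundary `g = 0`.
  let ψ : ℕ → EuclideanSpace ℝ (Fin n) → ℝ := fun k x =>
    Real.smoothTransition (-(k * g x) - 1)
  -- The weight of the boundary layer `1 ≤ -k g ≤ 2`: it is the coefficient of `-dg` in the
  -- derivative of `ρ ψₖ`.
  let s : ℕ → EuclideanSpace ℝ (Fin n) → ℝ := fun k x =>
    ρ x * (k * deriv Real.smoothTransition (-(k * g x) - 1))
  let a : ℕ → EuclideanSpace ℝ (Fin n) → ℝ := fun k x => ρ x * ψ k x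
  have hs0 : ∀ k x, 0 ≤ s k x := fun k x =>
    mul_nonneg (hρ0 x) (mul_nonneg k.cast_nonneg (deriv_smoothTransition_nonneg _))
  have hψ0 : ∀ k x, 0 ≤ ψ k x := fun k x => Real.smoothTransition.nonneg _
  have hψ1 : ∀ k x, ψ k x ≤ 1 := fun k x => Real.smoothTransition.le_one _
  have htsρ : ∀ k, tsupport (a k) ⊆ tsupport ρ := fun k => tsupport_mul_subset_left
  have hts : ∀ k, tsupport (a k) ⊆ A := by
    intro k x hx
    have hxU := hρU (htsρ k hx)
    refine ⟨?_, hxU⟩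
    by_contra hxω
    have h0 : 0 ≤ g x := not_lt.1 fun h => hxω ((hgω x hxU).2 h)
    have hcont : ContinuousAt (fun y => -(k * g y) - 1) x := by
      have := (hgd x hxU).continuousAt
      fun_prop
    have hneg : -((k : ℝ) * g x) - 1 < 0 := by
      have : 0 ≤ (k : ℝ) * g x := by positivity
      linarith
    refine notMem_tsupport_iff_eventuallyEq.2 ?_ hx
    filter_upwards [hcont.eventually (gt_mem_nhds hneg)] with y hy
    simp [a, ψ, Real.smoothTransition.zero_of_nonpos hy.le]
  have hψd : ∀ k, ContDiffOn ℝ 1 (ψ k) U := fun k =>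
    (Real.smoothTransition.contDiff (n := 1)).comp_contDiffOn (by fun_prop)
  have had : ∀ k, ContDiff ℝ 1 (a k) := fun k => contDiff_of_forall_mem_tsupport fun x hx =>
    hρ.contDiffAt.mul ((hψd k).contDiffAt (hU.mem_nhds (hts k hx).2))
  have hac : ∀ k, HasCompactSupport (a k) := fun k => hρc.mono' ((subset_tsupport _).trans (htsρ k))
  have hfa : ∀ k, ∀ x ∈ A, fderiv ℝ (a k) x = ψ k x • fderiv ℝ ρ x - s k x • fderiv ℝ g x := by
    intro k x hx
    have h1 : HasFDerivAt (fun y => -(k * g y) - 1) (-((k : ℝ) • fderiv ℝ g x)) x :=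
      (((hgd x hx.2).const_mul (k : ℝ)).neg).sub_const 1
    have h2 : HasDerivAt Real.smoothTransition (deriv Real.smoothTransition (-(k * g x) - 1))
        (-(k * g x) - 1) :=
      ((Real.smoothTransition.contDiffAt (n := 1)).differentiableAt (by simp)).hasDerivAt
    have h3 := (hρd x).mul (h2.comp_hasFDerivAt x h1)
    refine (HasFDerivAt.fderiv h3).trans ?_
    ext v
    simp [ψ, s]
    ring
  have hψc : ∀ k, ContinuousOn (ψ k) A := fun k => ((hψd k).continuousOn).mono inter_subset_right
  have hsc : ∀ k, ContinuousOn (s k) A := by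
    intro k
    have h1 : Continuous (deriv Real.smoothTransition) :=
      (Real.smoothTransition.contDiff (n := 1)).continuous_deriv (by simp)
    have h2 : ContinuousOn g A := hg.continuousOn.mono inter_subset_right
    have h3 := hρ.continuous
    exact h3.continuousOn.mul (continuousOn_const.mul (h1.comp_continuousOn (by fun_prop)))
  have hWd : ∀ k, ContDiff ℝ 1 (fun x => a k x • V x) := fun k => contDiff_of_forall_mem_tsupport fun x hx =>
    (had k).contDiffAt.smul (hV.contDiffAt
      (hω.mem_nhds (hts k (tsupport_smul_subset_left (a k) V hx)).1))
  have hWc : ∀ k, HasCompactSupport (fun x => a k x • V x) := fun k => (hac k).smul_right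
  have hK : IsCompact (closure ω) := hωb.isCompact_closure
  have hPint : IntegrableOn P A := by
    have h1 : IntegrableOn (fun x => ρ x * divergence V x + fderiv ℝ ρ x (V x)) ω := by
      refine Integrable.add ?_ ?_
      · obtain ⟨M, hM⟩ := hρc.exists_bound_of_continuous hρ.continuous
        exact Integrable.bdd_mul hdiv hρ.continuous.aestronglyMeasurable
          (Eventually.of_forall hM)
      · exact ((hρ'.continuousOn.clm_apply hVc).integrableOn_compact hK).mono_set subset_closure
    refine (h1.congr_fun (fun x hx => ?_) hω.measurableSet).mono_set inter_subset_left
    exact (divergence_smul (hρd x).differentiableAt (hVd x hx)).symm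
  have hdivW : ∀ k, ∀ x ∈ A, divergence (fun y => a k y • V y) x =
      ψ k x * P x - s k x * fderiv ℝ g x (V x) := by
    intro k x hx
    rw [divergence_smul ((had k).differentiable one_ne_zero x) (hVd x hx.1), hfa k x hx, hP,
      divergence_smul (hρd x).differentiableAt (hVd x hx.1)]
    simp [a]
    ring
  have hPc : ContinuousOn P A := by
    have h1 : ContDiffOn ℝ 1 (fun y => ρ y • V y) ω := hρ.contDiffOn.smul hV
    exact (continuousOn_divergence hω h1).mono inter_subset_left
  have hψP : ∀ k, IntegrableOn (fun x => ψ k x * P x) A := by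
    intro k
    refine Integrable.bdd_mul (c := 1) hPint ((hψc k).aestronglyMeasurable hAm)
      (Eventually.of_forall fun x => ?_)
    rw [Real.norm_of_nonneg (hψ0 k x)]
    exact hψ1 k x
  have hdivWint : ∀ k, Integrable (divergence fun y => a k y • V y) := fun k =>
    (continuous_divergence (hWd k)).integrable_of_hasCompactSupport
      ((hWc k).mono' fun x hx => by
        by_contra h
        exact hx (divergence_eq_zero_of_notMem_tsupport h))
  have hdivW0 : ∀ k, ∫ x in A, divergence (fun y => a k y • V y) x = 0 := by
    intro k
    rw [setIntegral_eq_integral_of_forall_compl_eq_zero fun x hx =>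
      divergence_eq_zero_of_notMem_tsupport fun h =>
        hx (hts k (tsupport_smul_subset_left (a k) V h))]
    exact integral_divergence_eq_zero_of_hasCompactSupport (hWd k) (hWc k)
  -- The field `ρ ψₖ V` has compact support inside `ω`, so its total divergence vanishes and the
  -- bulk term equals the flux through the layer.
  have hflux : ∀ k, ∫ x in A, ψ k x * P x = ∫ x in A, s k x * fderiv ℝ g x (V x) := by
    intro k
    have h1 : ∫ x in A, s k x * fderiv ℝ g x (V x) =
        ∫ x in A, (ψ k x * P x - divergence (fun y => a k y • V y) x) :=
      setIntegral_congr_fun hAm fun x hx => by simp only [hdivW k x hx]; ring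
    rw [h1, integral_sub (hψP k) (hdivWint k).integrableOn, hdivW0, sub_zero]
  set C := ∫ x in A, |fderiv ℝ ρ x e| with hC
  have hρe : Integrable (fun x => fderiv ℝ ρ x e) :=
    (hρ'.clm_apply continuous_const).integrable_of_hasCompactSupport (hρc.fderiv_apply ℝ e)
  have hψρ : ∀ k, IntegrableOn (fun x => ψ k x * fderiv ℝ ρ x e) A := by
    intro k
    refine Integrable.bdd_mul (c := 1) hρe.integrableOn ((hψc k).aestronglyMeasurable hAm)
      (Eventually.of_forall fun x => ?_)
    rw [Real.norm_of_nonneg (hψ0 k x)]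
    exact hψ1 k x
  have hae : ∀ k, Integrable (fun x => fderiv ℝ (a k) x e) := fun k =>
    (((had k).continuous_fderiv one_ne_zero).clm_apply
      continuous_const).integrable_of_hasCompactSupport ((hac k).fderiv_apply ℝ e)
  -- The same cutoff tested with the constant transversal field `e` bounds the mass of the layer by
  -- `C / c`, uniformly in `k`.
  have hcs : ∀ k, ∀ x ∈ A, c * s k x ≤ ψ k x * fderiv ℝ ρ x e - fderiv ℝ (a k) x e := by
    intro k x hx
    have h1 : fderiv ℝ (a k) x e = ψ k x * fderiv ℝ ρ x e - s k x * fderiv ℝ g x e := by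
      rw [hfa k x hx]; simp
    rw [h1]
    nlinarith [hs0 k x, hge x hx.2]
  have hcsint : ∀ k, IntegrableOn (fun x => c * s k x) A := by
    intro k
    refine Integrable.mono' ((hψρ k).sub (hae k).integrableOn)
      ((continuousOn_const.mul (hsc k)).aestronglyMeasurable hAm) ?_
    refine ae_restrict_of_forall_mem hAm fun x hx => ?_
    rw [Real.norm_of_nonneg (mul_nonneg hc.le (hs0 k x))]
    exact hcs k x hx
  have hae0 : ∀ k, ∫ x in A, fderiv ℝ (a k) x e = 0 := by
    intro k
    rw [setIntegral_eq_integral_of_forall_compl_eq_zero]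
    · exact integral_fderiv_apply_eq_zero (had k) (hac k) e
    · intro x hx
      by_contra h
      exact hx (hts k (support_fderiv_subset ℝ (f := a k) fun h0 => h (by rw [h0]; rfl)))
  have hcsC : ∀ k, ∫ x in A, c * s k x ≤ C := by
    intro k
    calc ∫ x in A, c * s k x
        ≤ ∫ x in A, (ψ k x * fderiv ℝ ρ x e - fderiv ℝ (a k) x e) :=
          setIntegral_mono_on (hcsint k) ((hψρ k).sub (hae k).integrableOn) hAm (hcs k)
      _ = ∫ x in A, ψ k x * fderiv ℝ ρ x e := by
          rw [integral_sub (hψρ k) (hae k).integrableOn, hae0, sub_zero]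
      _ ≤ C := by
          refine setIntegral_mono_on (hψρ k) hρe.integrableOn.abs hAm fun x _ => ?_
          calc ψ k x * fderiv ℝ ρ x e ≤ ψ k x * |fderiv ℝ ρ x e| :=
                mul_le_mul_of_nonneg_left (le_abs_self _) (hψ0 k x)
            _ ≤ 1 * |fderiv ℝ ρ x e| := mul_le_mul_of_nonneg_right (hψ1 k x) (abs_nonneg _)
            _ = _ := one_mul _
  have hlim : Tendsto (fun k => ∫ x in A, ψ k x * P x) atTop (𝓝 (∫ x in A, P x)) := by
    refine tendsto_integral_of_dominated_convergence (fun x => |P x|)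
      (fun k => (hψP k).aestronglyMeasurable) hPint.abs
      (fun k => Eventually.of_forall fun x => ?_)
      (ae_restrict_of_forall_mem hAm fun x hx => ?_)
    · rw [norm_mul, Real.norm_of_nonneg (hψ0 k x)]
      exact mul_le_of_le_one_left (norm_nonneg _) (hψ1 k x)
    · have hgx : 0 < -g x := by linarith [(hgω x hx.2).1 hx.1]
      have h1 : ∀ᶠ k : ℕ in atTop, 2 ≤ (k : ℝ) * (-g x) :=
        (tendsto_natCast_atTop_atTop.atTop_mul_const hgx).eventually_ge_atTop 2
      refine tendsto_const_nhds.congr' ?_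
      filter_upwards [h1] with k hk
      simp [ψ, Real.smoothTransition.one_of_one_le (show 1 ≤ -((k : ℝ) * g x) - 1 by linarith)]
  -- By tangency, the compact set where `|dg(V)| ≥ δ` contains no boundary point, so `-g` has a
  -- positive lower bound `κ` on it.
  have hsmall : ∀ δ > 0, ∃ κ > 0, ∀ x ∈ tsupport ρ ∩ ω, -κ < g x → |fderiv ℝ g x (V x)| ≤ δ := by
    intro δ hδ
    have hKc : IsCompact (tsupport ρ ∩ closure ω) := hρc.isCompact.inter hK
    have hfc : ContinuousOn (fun x => |fderiv ℝ g x (V x)|) (tsupport ρ ∩ closure ω) :=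
      ((hgc.mono fun x hx => hρU hx.1).clm_apply (hVc.mono inter_subset_right)).abs
    have hK' : IsCompact ((tsupport ρ ∩ closure ω) ∩ (fun x => |fderiv ℝ g x (V x)|) ⁻¹' Ici δ) :=
      hKc.of_isClosed_subset (hfc.preimage_isClosed_of_isClosed hKc.isClosed isClosed_Ici)
        inter_subset_left
    obtain ⟨κ, hκ, hκ'⟩ := hK'.exists_forall_le' (f := fun x => -g x) (a := 0)
      ((hg.continuousOn.mono fun x hx => hρU hx.1.1).neg) (by
        rintro x ⟨⟨hx1, hx2⟩, hx3⟩
        have hxω : x ∈ ω := by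
          by_contra h
          have := htan x ⟨hρU hx1, by rw [hω.frontier_eq]; exact ⟨hx2, h⟩⟩
          simp only [mem_preimage, this, abs_zero, mem_Ici] at hx3
          exact absurd hx3 (not_le.2 hδ)
        have := (hgω x (hρU hx1)).1 hxω
        simpa using this)
    refine ⟨κ, hκ, fun x hx hgx => ?_⟩
    by_contra h
    have := hκ' x ⟨⟨hx.1, subset_closure hx.2⟩, (not_le.1 h).le⟩
    linarith
  have hbound : ∀ δ > 0, |∫ x in A, P x| ≤ δ / c * C := by
    intro δ hδ
    obtain ⟨κ, hκ, hκ'⟩ := hsmall δ hδ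
    -- For such `k` the layer `-k g ≤ 2` lies inside `{g > -κ}`.
    have h1 : ∀ᶠ k : ℕ in atTop, 2 < (k : ℝ) * κ :=
      (tendsto_natCast_atTop_atTop.atTop_mul_const hκ).eventually_gt_atTop 2
    refine le_of_tendsto hlim.abs ?_
    filter_upwards [h1] with k hk
    rw [hflux k]
    have h2 : ∀ x ∈ A, ‖s k x * fderiv ℝ g x (V x)‖ ≤ δ / c * (c * s k x) := by
      intro x hx
      have e1 : δ / c * (c * s k x) = s k x * δ := by field_simp
      rw [e1, norm_mul, Real.norm_of_nonneg (hs0 k x), Real.norm_eq_abs]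
      by_cases hxρ : x ∈ tsupport ρ
      · rcases lt_or_ge (-κ) (g x) with h | h
        · exact mul_le_mul_of_nonneg_left (hκ' x ⟨hxρ, hx.1⟩ h) (hs0 k x)
        · have h3 : 1 < -((k : ℝ) * g x) - 1 := by
            have := mul_le_mul_of_nonneg_left h (Nat.cast_nonneg (α := ℝ) k)
            linarith
          simp [s, deriv_smoothTransition_of_one_lt h3]
      · simp [s, image_eq_zero_of_notMem_tsupport hxρ]
    calc |∫ x in A, s k x * fderiv ℝ g x (V x)| ≤ ∫ x in A, δ / c * (c * s k x) :=
          norm_integral_le_of_norm_le ((hcsint k).const_mul _) (ae_restrict_of_forall_mem hAm h2)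
      _ = δ / c * ∫ x in A, c * s k x := integral_const_mul _ _
      _ ≤ δ / c * C := mul_le_mul_of_nonneg_left (hcsC k) (by positivity)
  have hlim0 : Tendsto (fun δ : ℝ => δ / c * C) (𝓝[>] 0) (𝓝 0) := by
    have : Continuous fun δ : ℝ => δ / c * C := by fun_prop
    simpa using (this.tendsto 0).mono_left nhdsWithin_le_nhds
  have h0 : |∫ x in A, P x| ≤ 0 := ge_of_tendsto hlim0 (by
    filter_upwards [self_mem_nhdsWithin] with δ hδ using hbound δ hδ)
  rw [hPA]
  exact abs_eq_zero.1 (le_antisymm h0 (abs_nonneg _))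

end BoundaryLocalization

/-! ### Globalization by a partition of unity. -/

section DivergenceTheorem

variable {n : ℕ}

theorem setIntegral_divergence_smul_eq_zero_of_tsupport_subset
    {ω : Set (EuclideanSpace ℝ (Fin n))}
    {V : EuclideanSpace ℝ (Fin n) → EuclideanSpace ℝ (Fin n)} (hω : IsOpen ω)
    (hV : ContDiffOn ℝ 1 V ω)
    {ρ : EuclideanSpace ℝ (Fin n) → ℝ} (hρ : ContDiff ℝ 1 ρ) (hρc : HasCompactSupport ρ)
    (hρω : tsupport ρ ⊆ ω) :
    ∫ x in ω, divergence (fun y => ρ y • V y) x = 0 := by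
  have hts : tsupport (fun y => ρ y • V y) ⊆ ω :=
    (tsupport_smul_subset_left ρ V).trans hρω
  rw [setIntegral_eq_integral_of_forall_compl_eq_zero fun x hx =>
    divergence_eq_zero_of_notMem_tsupport fun h => hx (hts h)]
  exact integral_divergence_eq_zero_of_hasCompactSupport
    (contDiff_of_forall_mem_tsupport fun x hx =>
      hρ.contDiffAt.smul (hV.contDiffAt (hω.mem_nhds (hts hx)))) hρc.smul_right

/-- A defining function of `ω` near `p` remains one at the boundary points near `p`, and the
derivative in the direction of its gradient stays positive. -/
theorem IsLocalDefiningFunction.exists_nhds {k : ℕ∞} (hk : 1 ≤ k)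
    {ω : Set (EuclideanSpace ℝ (Fin n))} (hω : IsOpen ω) {p : EuclideanSpace ℝ (Fin n)}
    {g : EuclideanSpace ℝ (Fin n) → ℝ} (h : IsLocalDefiningFunction k ω p g) :
    ∃ U, IsOpen U ∧ p ∈ U ∧ ContDiffOn ℝ k g U ∧ (∀ x ∈ U, x ∈ ω ↔ g x < 0) ∧
      (∃ c > 0, ∃ e, ∀ x ∈ U, c ≤ fderiv ℝ g x e) ∧
      ∀ x ∈ U ∩ frontier ω, IsLocalDefiningFunction k ω x g := by
  obtain ⟨U, hU, hp, hg, hgω, -, hne⟩ := h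
  have hk1 : (1 : WithTop ℕ∞) ≤ k := by exact_mod_cast hk
  have hgc : ContinuousOn (fderiv ℝ g) U := hg.continuousOn_fderiv_of_isOpen hU hk1
  set e := gradient g p with he
  have hpe : fderiv ℝ g p e = ‖e‖ ^ 2 := by
    rw [← inner_gradient_left, ← he, real_inner_self_eq_norm_sq]
  have hpos : 0 < ‖e‖ ^ 2 := by positivity
  have hcont : ContinuousAt (fun x => fderiv ℝ g x e) p :=
    (hgc.continuousAt (hU.mem_nhds hp)).clm_apply continuousAt_const
  have hev : ∀ᶠ x in 𝓝 p, ‖e‖ ^ 2 / 2 < fderiv ℝ g x e :=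
    hcont.eventually (lt_mem_nhds (by simp only [hpe]; linarith))
  obtain ⟨U', hU', hU'o, hpU'⟩ := eventually_nhds_iff.1 hev
  refine ⟨U ∩ U', hU.inter hU'o, ⟨hp, hpU'⟩, hg.mono inter_subset_left,
    fun x hx => hgω x hx.1, ⟨‖e‖ ^ 2 / 2, by positivity, e, fun x hx => (hU' x hx.2).le⟩, ?_⟩
  rintro x ⟨⟨hxU, hxU'⟩, hxω⟩
  rw [hω.frontier_eq] at hxω
  -- At a boundary point `g` is a limit of negative values from `ω`, yet not negative as the point
  -- is outside `ω`; hence it is zero.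
  refine ⟨U, hU, hxU, hg, hgω, le_antisymm ?_ ?_, ?_⟩
  · have hx' : x ∈ closure (U ∩ ω) := hU.inter_closure ⟨hxU, hxω.1⟩
    have hcx : ContinuousWithinAt g (U ∩ ω) x :=
      (hg.continuousOn.continuousWithinAt hxU).mono inter_subset_left
    have := mem_closure_iff_nhdsWithin_neBot.1 hx'
    refine le_of_tendsto hcx ?_
    filter_upwards [self_mem_nhdsWithin] with y hy using ((hgω y hy.1).1 hy.2).le
  · exact not_lt.1 fun h => hxω.2 ((hgω x hxU).2 h)
  · intro h0
    have h1 := hU' x hxU'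
    rw [← inner_gradient_left, h0, inner_zero_left] at h1
    linarith

/-- **Divergence theorem** on a smooth bounded domain for vector fields that are tangential to the
boundary. -/
theorem IsSmoothBoundedDomain.setIntegral_divergence_eq_zero
    {ω : Set (EuclideanSpace ℝ (Fin n))} (hω : IsSmoothBoundedDomain ω)
    {V : EuclideanSpace ℝ (Fin n) → EuclideanSpace ℝ (Fin n)} (hVc : ContinuousOn V (closure ω))
    (hV : ContDiffOn ℝ 1 V ω) (hdiv : IntegrableOn (divergence V) ω)
    (htan : ∀ p ∈ frontier ω, ∀ g, IsLocalDefiningFunction (⊤ : ℕ∞) ω p g →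
      ⟪gradient g p, V p⟫ = 0) :
    ∫ x in ω, divergence V x = 0 := by
  have hK : IsCompact (closure ω) := hω.isBounded.isCompact_closure
  have hloc : ∀ p ∈ closure ω, ∃ U : Set (EuclideanSpace ℝ (Fin n)), IsOpen U ∧ p ∈ U ∧
      ∀ ρ : EuclideanSpace ℝ (Fin n) → ℝ, ContDiff ℝ 1 ρ → tsupport ρ ⊆ U → (∀ x, 0 ≤ ρ x) →
        ∫ x in ω, divergence (fun y => ρ y • V y) x = 0 := by
    intro p hp
    by_cases hpω : p ∈ ω
    · refine ⟨ω, hω.isOpen, hpω, fun ρ hρ hρω _ => ?_⟩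
      exact setIntegral_divergence_smul_eq_zero_of_tsupport_subset hω.isOpen hV hρ
        (Metric.isCompact_of_isClosed_isBounded (isClosed_tsupport ρ)
          (hω.isBounded.subset hρω)) hρω
    · have hpf : p ∈ frontier ω := by rw [hω.isOpen.frontier_eq]; exact ⟨hp, hpω⟩
      obtain ⟨g, hg⟩ := hω.smooth_boundary p hpf
      obtain ⟨U, hU, hpU, hgU, hgω, ⟨c, hc, e, hge⟩, hgf⟩ := hg.exists_nhds le_top hω.isOpen
      -- The ball only serves to make the support of `ρ` compact.
      refine ⟨U ∩ Metric.ball p 1, hU.inter Metric.isOpen_ball, ⟨hpU, Metric.mem_ball_self one_pos⟩,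
        fun ρ hρ hρU hρ0 => ?_⟩
      refine setIntegral_divergence_smul_eq_zero_of_tangential hω.isOpen hω.isBounded hVc hV hdiv hU
        (hgU.of_le (by exact_mod_cast le_top)) hgω (fun x hx => ?_) hc hge hρ
        (Metric.isCompact_of_isClosed_isBounded (isClosed_tsupport ρ)
          (Metric.isBounded_ball.subset (hρU.trans inter_subset_right)))
        (hρU.trans inter_subset_left) hρ0
      rw [← inner_gradient_left]
      exact htan x hx.2 g (hgf x hx)
  choose! U hUo hpU hU using hloc
  obtain ⟨t, ht, hcov⟩ := hK.elim_nhds_subcover U fun p hp => (hUo p hp).mem_nhds (hpU p hp)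
  obtain ⟨f, hf⟩ := SmoothPartitionOfUnity.exists_isSubordinate
    (I := modelWithCornersSelf ℝ (EuclideanSpace ℝ (Fin n))) isClosed_closure
    (fun p : t => U p) (fun p => hUo _ (ht p p.2)) (by
      simpa [iUnion_subtype] using hcov)
  have hfd : ∀ i, ContDiff ℝ 1 (f i) := fun i =>
    ((f i).contMDiff.contDiff).of_le (by exact_mod_cast le_top)
  have hsum : ∀ x ∈ ω, ∑ i, f i x = 1 := fun x hx => by
    rw [← finsum_eq_sum_of_fintype]
    exact f.sum_eq_one (subset_closure hx)
  have hVd : ∀ x ∈ ω, DifferentiableAt ℝ V x := fun x hx =>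
    (hV.contDiffAt (hω.isOpen.mem_nhds hx)).differentiableAt one_ne_zero
  have hsmul : ∀ i, ∀ x ∈ ω, divergence (fun y => f i y • V y) x =
      f i x * divergence V x + fderiv ℝ (f i) x (V x) := fun i x hx =>
    divergence_smul ((hfd i).differentiable one_ne_zero x) (hVd x hx)
  have hint : ∀ i, IntegrableOn (divergence fun y => f i y • V y) ω := by
    intro i
    have h1 : IntegrableOn (fun x => f i x * divergence V x + fderiv ℝ (f i) x (V x)) ω := by
      refine Integrable.add ?_ ?_
      · refine Integrable.bdd_mul (c := 1) hdiv (hfd i).continuous.aestronglyMeasurable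
          (Eventually.of_forall fun x => ?_)
        rw [Real.norm_of_nonneg (f.nonneg i x)]
        exact f.le_one i x
      · exact ((((hfd i).continuous_fderiv one_ne_zero).continuousOn.clm_apply
          hVc).integrableOn_compact hK).mono_set subset_closure
    exact h1.congr_fun (fun x hx => (hsmul i x hx).symm) hω.isOpen.measurableSet
  have hdecomp : ∀ x ∈ ω, divergence V x = ∑ i, divergence (fun y => f i y • V y) x := by
    intro x hx
    -- The partition sums to `1` on the whole open set `ω`, so the terms with derivatives of the
    -- cutoffs cancel.
    have h0 : ∑ i, fderiv ℝ (f i) x = 0 := by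
      rw [← fderiv_fun_sum fun i _ => (hfd i).differentiable one_ne_zero x]
      have : (fun y => ∑ i, f i y) =ᶠ[𝓝 x] fun _ => (1 : ℝ) := by
        filter_upwards [hω.isOpen.mem_nhds hx] with y hy using hsum y hy
      rw [this.fderiv_eq, fderiv_const_apply]
    have h1 : ∑ i, fderiv ℝ (f i) x (V x) = 0 := by
      rw [← _root_.sum_apply, h0]; rfl
    rw [Finset.sum_congr rfl fun i _ => hsmul i x hx, Finset.sum_add_distrib, h1,
      ← Finset.sum_mul, hsum x hx, one_mul, add_zero]
  rw [setIntegral_congr_fun hω.isOpen.measurableSet hdecomp, integral_finsetSum _ fun i _ => hint i]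
  exact Finset.sum_eq_zero fun i _ => hU i (ht i i.2) _ (hfd i) (hf i) (f.nonneg i)

end DivergenceTheorem

/-! ### Comparison of Hausdorff measures and the linear model of a graph. -/

section Area

variable {n : ℕ}

@[simp]
theorem base_graphMap (φ : EuclideanSpace ℝ (Fin n) → ℝ) (y : EuclideanSpace ℝ (Fin n)) :
    base (graphMap φ y) = y := by
  ext i; simp [base, graphMap]

@[simp]
theorem height_graphMap (φ : EuclideanSpace ℝ (Fin n) → ℝ) (y : EuclideanSpace ℝ (Fin n)) :
    height (graphMap φ y) = φ y := by
  simp [height, graphMap]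

theorem ext_base_height {x z : EuclideanSpace ℝ (Fin (n + 1))} (h : base x = base z)
    (h' : height x = height z) : x = z := by
  ext i
  refine Fin.lastCases h' (fun j => ?_) i
  exact congrArg (fun v : EuclideanSpace ℝ (Fin n) => v j) h

theorem graphMap_mem_graph {ω : Set (EuclideanSpace ℝ (Fin n))}
    (φ : EuclideanSpace ℝ (Fin n) → ℝ) {y : EuclideanSpace ℝ (Fin n)} (hy : y ∈ ω) :
    graphMap φ y ∈ graph ω φ := by
  simpa [graph] using hy

theorem graphMap_base {ω : Set (EuclideanSpace ℝ (Fin n))} {φ : EuclideanSpace ℝ (Fin n) → ℝ}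
    {x : EuclideanSpace ℝ (Fin (n + 1))} (hx : x ∈ graph ω φ) : graphMap φ (base x) = x :=
  ext_base_height (by simp) (by simpa using hx.2.symm)

theorem continuous_base : Continuous (base (n := n)) := by
  unfold base; fun_prop

theorem continuous_height : Continuous (height (n := n)) := by
  unfold height; fun_prop

theorem norm_sq_eq_base_add_height (x : EuclideanSpace ℝ (Fin (n + 1))) :
    ‖x‖ ^ 2 = ‖base x‖ ^ 2 + height x ^ 2 := by
  simp [EuclideanSpace.norm_sq_eq, Fin.sum_univ_castSucc, base, height]

/-- Same shape as `norm_stretch_sq`, so comparing the graph with its linear model reduces to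
comparing increments of `φ` with those of its derivative. -/
theorem dist_graphMap_sq (φ : EuclideanSpace ℝ (Fin n) → ℝ) (y z : EuclideanSpace ℝ (Fin n)) :
    dist (graphMap φ y) (graphMap φ z) ^ 2 = ‖y - z‖ ^ 2 + (φ y - φ z) ^ 2 := by
  have h1 : base (graphMap φ y - graphMap φ z) = y - z := by ext i; simp [base, graphMap]
  have h2 : height (graphMap φ y - graphMap φ z) = φ y - φ z := by simp [height, graphMap]
  rw [dist_eq_norm, norm_sq_eq_base_add_height, h1, h2]

theorem measurableSet_graph {ω : Set (EuclideanSpace ℝ (Fin n))} (hω : IsOpen ω)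
    {φ : EuclideanSpace ℝ (Fin n) → ℝ} (hφ : ContinuousOn φ ω) : MeasurableSet (graph ω φ) := by
  have ho : IsOpen (base ⁻¹' ω) := hω.preimage continuous_base
  have hc : ContinuousOn (fun x => height x - φ (base x)) (base ⁻¹' ω) :=
    continuous_height.continuousOn.sub
      (hφ.comp continuous_base.continuousOn fun x hx => hx)
  obtain ⟨t, ht, hte⟩ := continuousOn_iff_isClosed.1 hc {0} isClosed_singleton
  have : graph ω φ = t ∩ base ⁻¹' ω := by
    rw [← hte]
    ext x
    simp [graph, sub_eq_zero, and_comm]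
  rw [this]
  exact ht.measurableSet.inter ho.measurableSet

/-- If `f` expands distances on `A` at most `K` times more than `g`, its image of `A` has at most
`K ^ d` times larger measure. -/
theorem euclideanHausdorffMeasure_image_le_of_dist_le {X Y Z : Type*} [MetricSpace Y]
    [MeasurableSpace Y] [BorelSpace Y] [MetricSpace Z] [MeasurableSpace Z] [BorelSpace Z]
    {f : X → Y} {g : X → Z} {A : Set X} {K : NNReal}
    (h : ∀ x ∈ A, ∀ y ∈ A, dist (f x) (f y) ≤ K * dist (g x) (g y)) (d : ℕ) :
    μHE[d] (f '' A) ≤ (K : ENNReal) ^ d * μHE[d] (g '' A) := by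
  rcases A.eq_empty_or_nonempty with rfl | ⟨x₀, -⟩
  · simp
  have : Nonempty X := ⟨x₀⟩
  have hinv : ∀ z ∈ g '' A, Function.invFunOn g A z ∈ A ∧ g (Function.invFunOn g A z) = z :=
    fun z hz => ⟨Function.invFunOn_mem hz, Function.invFunOn_eq hz⟩
  have hL : LipschitzOnWith K (f ∘ Function.invFunOn g A) (g '' A) := by
    refine LipschitzOnWith.of_dist_le_mul fun z hz w hw => ?_
    have := h _ (hinv z hz).1 _ (hinv w hw).1
    rwa [(hinv z hz).2, (hinv w hw).2] at this
  -- The choice of preimages under `g` is harmless: by `h`, points of `A` with equal `g` have equal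
  -- `f`.
  have himg : (f ∘ Function.invFunOn g A) '' (g '' A) = f '' A := by
    rw [image_image]
    refine image_congr fun x hx => ?_
    have hx' := hinv (g x) (mem_image_of_mem g hx)
    have := h _ hx'.1 x hx
    rw [hx'.2, dist_self, mul_zero] at this
    exact dist_le_zero.1 this
  have := hL.hausdorffMeasure_image_le (d := d) d.cast_nonneg
  rw [himg, ENNReal.rpow_natCast] at this
  simp only [Measure.euclideanHausdorffMeasure_def, Measure.smul_apply, ENNReal.smul_def,
    smul_eq_mul]
  rw [mul_left_comm]
  gcongr

/-- A self-map of `ℝⁿ` with `‖stretch a v‖² = ‖v‖² + ⟪a, v⟫²`. -/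
def stretch (a : EuclideanSpace ℝ (Fin n)) : EuclideanSpace ℝ (Fin n) →ₗ[ℝ]
    EuclideanSpace ℝ (Fin n) :=
  LinearMap.transvection (innerSL ℝ a).toLinearMap ((1 + √(1 + ‖a‖ ^ 2))⁻¹ • a)

theorem sq_sqrt_one_add_norm_sq (a : EuclideanSpace ℝ (Fin n)) :
    √(1 + ‖a‖ ^ 2) ^ 2 = 1 + ‖a‖ ^ 2 :=
  Real.sq_sqrt (by positivity)

/-- The coefficient `t = 1 / (1 + W)`, with `W² = 1 + ‖a‖²`, solves `2 t + t² ‖a‖² = 1`; thus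
`stretch a` is the symmetric square root of `1 + a aᵀ`. -/
theorem norm_stretch_sq (a v : EuclideanSpace ℝ (Fin n)) :
    ‖stretch a v‖ ^ 2 = ‖v‖ ^ 2 + ⟪a, v⟫ ^ 2 := by
  have h := sq_sqrt_one_add_norm_sq a
  have hp : 0 < 1 + √(1 + ‖a‖ ^ 2) := by positivity
  have ha : ‖a‖ ^ 2 = √(1 + ‖a‖ ^ 2) ^ 2 - 1 := by rw [h]; ring
  have e : stretch a v = v + (⟪a, v⟫ * (1 + √(1 + ‖a‖ ^ 2))⁻¹) • a := by
    simp [stretch, LinearMap.transvection.apply, smul_smul]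
  rw [e, norm_add_sq_real, inner_smul_right, norm_smul, mul_pow, real_inner_comm v a]
  generalize √(1 + ‖a‖ ^ 2) = W at *
  rw [ha, Real.norm_eq_abs, sq_abs]
  field_simp
  ring

theorem det_stretch (a : EuclideanSpace ℝ (Fin n)) :
    LinearMap.det (stretch a) = √(1 + ‖a‖ ^ 2) := by
  have h := sq_sqrt_one_add_norm_sq a
  have hp : 0 < 1 + √(1 + ‖a‖ ^ 2) := by positivity
  have ha : ‖a‖ ^ 2 = √(1 + ‖a‖ ^ 2) ^ 2 - 1 := by rw [h]; ring
  rw [stretch, LinearMap.transvection.det]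
  simp only [ContinuousLinearMap.coe_coe, innerSL_apply_apply, inner_smul_right,
    real_inner_self_eq_norm_sq]
  generalize √(1 + ‖a‖ ^ 2) = W at *
  rw [ha]
  field_simp
  ring

theorem euclideanHausdorffMeasure_stretch_image (a : EuclideanSpace ℝ (Fin n))
    (A : Set (EuclideanSpace ℝ (Fin n))) :
    μHE[n] (stretch a '' A) = ENNReal.ofReal √(1 + ‖a‖ ^ 2) * volume A := by
  rw [EuclideanSpace.euclideanHausdorffMeasure_eq_volume, Measure.addHaar_image_linearMap,
    det_stretch, abs_of_nonneg (Real.sqrt_nonneg _)]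

/-- The triangle inequality for the plane vectors `(h, p)` and `(h, q)` gives `u ≤ v + δ h`, and `h
≤ v`. -/
theorem le_mul_of_sq_eq_of_abs_sub_le {h p q u v δ : ℝ} (hδ : 0 ≤ δ) (h0 : 0 ≤ h)
    (hv0 : 0 ≤ v) (hu : u ^ 2 = h ^ 2 + p ^ 2) (hv : v ^ 2 = h ^ 2 + q ^ 2)
    (hr : |p - q| ≤ δ * h) : u ≤ (1 + δ) * v := by
  have h1 : h ≤ v := abs_le_of_sq_le_sq' (by nlinarith [sq_nonneg q]) hv0 |>.2
  have h2 : |q| ≤ v := abs_le_of_sq_le_sq (by nlinarith [sq_nonneg h]) hv0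
  have h3 : |p| ≤ |q| + δ * h := by
    have := abs_sub_abs_le_abs_sub p q
    linarith
  have h4 : p ^ 2 ≤ (|q| + δ * h) ^ 2 := by
    rw [← sq_abs p]; exact pow_le_pow_left₀ (abs_nonneg _) h3 2
  have h5 : |q| * h ≤ v * v := mul_le_mul h2 h1 h0 hv0
  have h6 : h * h ≤ v * v := mul_le_mul h1 h1 h0 hv0
  refine le_of_sq_le_sq (a := u) ?_ (by positivity)
  nlinarith [sq_abs q, mul_le_mul_of_nonneg_left h5 hδ, mul_le_mul_of_nonneg_left h6 (mul_nonneg hδ hδ)]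

/-- By the Lindelöf property countably many of the neighbourhoods cover `ω`; made disjoint, they
allow summing the local inequalities. -/
theorem le_restrict_of_locally_le {X : Type*} [TopologicalSpace X] [SecondCountableTopology X]
    [MeasurableSpace X] [OpensMeasurableSpace X] {μ ν : Measure X} {ω : Set X}
    (hω : MeasurableSet ω)
    (h : ∀ x ∈ ω, ∃ s ∈ 𝓝 x, ∀ A, MeasurableSet A → A ⊆ ω → A ⊆ s → μ A ≤ ν A) :
    μ.restrict ω ≤ ν.restrict ω := by
  refine Measure.le_iff.2 fun A hA => ?_
  rw [Measure.restrict_apply hA, Measure.restrict_apply hA]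
  choose! s hs hle using h
  obtain ⟨t, htω, htc, hcov⟩ := TopologicalSpace.countable_cover_nhdsWithin
    (f := fun x => interior (s x)) (s := ω)
    fun x hx => mem_nhdsWithin_of_mem_nhds (interior_mem_nhds.2 (hs x hx))
  rcases t.eq_empty_or_nonempty with rfl | hne
  · have : ω = ∅ := by simpa [subset_empty_iff] using hcov
    simp [this]
  obtain ⟨f, rfl⟩ := htc.exists_eq_range hne
  set S : ℕ → Set X := disjointed fun k => interior (s (f k)) with hS
  have hSm : ∀ k, MeasurableSet (A ∩ ω ∩ S k) := fun k =>
    (hA.inter hω).inter (MeasurableSet.disjointed (fun i => isOpen_interior.measurableSet) k)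
  have hSd : Pairwise (Function.onFun Disjoint fun k => A ∩ ω ∩ S k) := fun i j hij =>
    (disjoint_disjointed _ hij).mono inter_subset_right inter_subset_right
  have hU : A ∩ ω = ⋃ k, A ∩ ω ∩ S k := by
    rw [← inter_iUnion, hS, iUnion_disjointed]
    refine (inter_eq_left.2 fun x hx => ?_).symm
    simpa using hcov hx.2
  rw [hU, measure_iUnion hSd hSm, measure_iUnion hSd hSm]
  refine ENNReal.tsum_le_tsum fun k => hle (f k) (htω (mem_range_self k)) _ (hSm k)
    (fun x hx => hx.1.2) fun x hx => interior_subset (disjointed_subset _ k hx.2)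

end Area

/-! ### The surface measure of a graph. -/

section AreaFormula

variable {n : ℕ}

theorem map_base_restrict_graph_apply {ω : Set (EuclideanSpace ℝ (Fin n))}
    {φ : EuclideanSpace ℝ (Fin n) → ℝ} {A : Set (EuclideanSpace ℝ (Fin n))} (hA : MeasurableSet A)
    (hAω : A ⊆ ω) :
    (μHE[n].restrict (graph ω φ)).map base A = μHE[n] (graphMap φ '' A) := by
  rw [Measure.map_apply continuous_base.measurable hA,
    Measure.restrict_apply (continuous_base.measurable hA)]
  congr 1
  ext x
  constructor
  · rintro ⟨hx, hxg⟩
    exact ⟨base x, hx, graphMap_base hxg⟩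
  · rintro ⟨y, hy, rfl⟩
    exact ⟨by simpa using hy, graphMap_mem_graph φ (hAω hy)⟩

theorem measurable_gradient (φ : EuclideanSpace ℝ (Fin n) → ℝ) : Measurable (gradient φ) :=
  ((InnerProductSpace.toDual ℝ (EuclideanSpace ℝ (Fin n))).symm.continuous.measurable).comp
    (measurable_fderiv ℝ φ)

theorem continuousAt_gradient {φ : EuclideanSpace ℝ (Fin n) → ℝ} {y : EuclideanSpace ℝ (Fin n)}
    (h : ContDiffAt ℝ 1 φ y) : ContinuousAt (gradient φ) y :=
  (InnerProductSpace.toDual ℝ (EuclideanSpace ℝ (Fin n))).symm.continuous.continuousAt.comp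
    (h.continuousAt_fderiv one_ne_zero)

/-- The area density `√(1 + |∇φ|²)` of the graph of `φ`. -/
def areaDensity (φ : EuclideanSpace ℝ (Fin n) → ℝ) (y : EuclideanSpace ℝ (Fin n)) : NNReal :=
  Real.toNNReal √(1 + ‖gradient φ y‖ ^ 2)

theorem coe_areaDensity (φ : EuclideanSpace ℝ (Fin n) → ℝ) (y : EuclideanSpace ℝ (Fin n)) :
    (areaDensity φ y : ℝ) = √(1 + ‖gradient φ y‖ ^ 2) :=
  Real.coe_toNNReal _ (Real.sqrt_nonneg _)

theorem areaDensity_pos (φ : EuclideanSpace ℝ (Fin n) → ℝ) (y : EuclideanSpace ℝ (Fin n)) :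
    0 < areaDensity φ y :=
  Real.toNNReal_pos.2 (by positivity)

theorem measurable_areaDensity (φ : EuclideanSpace ℝ (Fin n) → ℝ) :
    Measurable (areaDensity φ) := by
  have := measurable_gradient φ
  unfold areaDensity
  fun_prop

theorem continuousAt_areaDensity {φ : EuclideanSpace ℝ (Fin n) → ℝ} {y : EuclideanSpace ℝ (Fin n)}
    (h : ContDiffAt ℝ 1 φ y) : ContinuousAt (areaDensity φ) y := by
  have h1 := continuousAt_gradient h
  have h2 : ContinuousAt (fun y => √(1 + ‖gradient φ y‖ ^ 2)) y := by fun_prop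
  exact continuous_real_toNNReal.continuousAt.comp h2

/-- Near a point, the area of a graph compares with the volume of its projection. -/
theorem exists_nhds_area_compare {φ : EuclideanSpace ℝ (Fin n) → ℝ}
    {p : EuclideanSpace ℝ (Fin n)} (h : ContDiffAt ℝ 1 φ p) {δ : NNReal} (hδ : 0 < δ) :
    ∃ s ∈ 𝓝 p, ∀ A ⊆ s,
      μHE[n] (graphMap φ '' A) ≤ (1 + δ : NNReal) ^ n * ((areaDensity φ p : ENNReal) * volume A) ∧
      (areaDensity φ p : ENNReal) * volume A ≤ (1 + δ : NNReal) ^ n * μHE[n] (graphMap φ '' A) := by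
  have hs := h.hasStrictFDerivAt one_ne_zero
  -- Strict differentiability controls increments between any two points near `p`, as a Lipschitz
  -- comparison requires.
  obtain ⟨s, hsp, hlin⟩ := hs.approximates_deriv_on_nhds (Or.inr hδ)
  refine ⟨s, hsp, fun A hA => ?_⟩
  have hvol : (areaDensity φ p : ENNReal) * volume A =
      μHE[n] (stretch (gradient φ p) '' A) :=
    (euclideanHausdorffMeasure_stretch_image _ _).symm
  have key : ∀ x ∈ A, ∀ y ∈ A, |φ x - φ y - ⟪gradient φ p, x - y⟫| ≤ δ * ‖x - y‖ := by
    intro x hx y hy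
    have := hlin x (hA hx) y (hA hy)
    rwa [Real.norm_eq_abs, ← inner_gradient_left] at this
  have hst : ∀ x y, dist (stretch (gradient φ p) x) (stretch (gradient φ p) y) ^ 2 =
      ‖x - y‖ ^ 2 + ⟪gradient φ p, x - y⟫ ^ 2 := fun x y => by
    rw [dist_eq_norm, ← map_sub, norm_stretch_sq]
  rw [hvol]
  constructor
  · refine euclideanHausdorffMeasure_image_le_of_dist_le (fun x hx y hy => ?_) n
    exact le_mul_of_sq_eq_of_abs_sub_le δ.2 (norm_nonneg _) dist_nonneg (dist_graphMap_sq φ x y)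
      (hst x y) (key x hx y hy)
  · refine euclideanHausdorffMeasure_image_le_of_dist_le (fun x hx y hy => ?_) n
    exact le_mul_of_sq_eq_of_abs_sub_le δ.2 (norm_nonneg _) dist_nonneg (hst x y)
      (dist_graphMap_sq φ x y) (by rw [abs_sub_comm]; exact key x hx y hy)

/-- The density is continuous and positive at `p`, so near `p` it stays within a factor `1 + δ` of
its value there. -/
theorem exists_nhds_density_compare {φ : EuclideanSpace ℝ (Fin n) → ℝ}
    {p : EuclideanSpace ℝ (Fin n)} (h : ContDiffAt ℝ 1 φ p) {δ : NNReal} (hδ : 0 < δ) :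
    ∃ s ∈ 𝓝 p, ∀ A ⊆ s, MeasurableSet A →
      ∫⁻ y in A, areaDensity φ y ≤ (1 + δ : NNReal) * ((areaDensity φ p : ENNReal) * volume A) ∧
      (areaDensity φ p : ENNReal) * volume A ≤ (1 + δ : NNReal) * ∫⁻ y in A, areaDensity φ y := by
  have hc := continuousAt_areaDensity h
  have hpos := areaDensity_pos φ p
  have h1 : areaDensity φ p < (1 + δ) * areaDensity φ p := lt_mul_of_one_lt_left hpos (by simpa)
  have h2 : ∀ᶠ y in 𝓝 p, areaDensity φ y < (1 + δ) * areaDensity φ p :=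
    hc.eventually (gt_mem_nhds h1)
  have h3 : ∀ᶠ y in 𝓝 p, areaDensity φ p < (1 + δ) * areaDensity φ y :=
    (hc.const_mul (1 + δ)).eventually (lt_mem_nhds h1)
  refine ⟨_, h2.and h3, fun A hA hAm => ⟨?_, ?_⟩⟩
  · calc ∫⁻ y in A, areaDensity φ y ≤ ∫⁻ _ in A, ((1 + δ) * areaDensity φ p : NNReal) :=
          setLIntegral_mono' hAm fun y hy => by exact_mod_cast (hA hy).1.le
      _ = _ := by rw [setLIntegral_const, ENNReal.coe_mul, mul_assoc]
  · calc (areaDensity φ p : ENNReal) * volume A = ∫⁻ _ in A, areaDensity φ p := by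
          rw [setLIntegral_const]
      _ ≤ ∫⁻ y in A, (1 + δ : NNReal) * (areaDensity φ y : ENNReal) :=
          setLIntegral_mono' hAm fun y hy => by exact_mod_cast (hA hy).2.le
      _ = _ := lintegral_const_mul _ (measurable_areaDensity φ).coe_nnreal_ennreal

theorem measure_le_of_forall_le_mul {X : Type*} [MeasurableSpace X] {μ ν : Measure X} (k : ℕ)
    (h : ∀ δ : NNReal, 0 < δ → μ ≤ ((1 + δ : NNReal) ^ k : ENNReal) • ν) : μ ≤ ν := by
  refine Measure.le_iff.2 fun A _ => ?_
  have hc : Tendsto (fun δ : NNReal => ((1 + δ : NNReal) ^ k : ENNReal)) (𝓝[>] 0) (𝓝 1) := by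
    have h1 : Continuous fun δ : NNReal => ((1 + δ) ^ k : NNReal) := by fun_prop
    have h2 := ENNReal.tendsto_coe.2 (h1.tendsto 0)
    simp only [ENNReal.coe_pow, add_zero, one_pow, ENNReal.coe_one] at h2
    exact h2.mono_left nhdsWithin_le_nhds
  have hl := ENNReal.Tendsto.mul_const (b := ν A) hc (Or.inl one_ne_zero)
  rw [one_mul] at hl
  refine ge_of_tendsto hl ?_
  filter_upwards [self_mem_nhdsWithin] with δ hδ
  simpa using h δ hδ A

/-- **Area formula** for a graph. -/
theorem map_base_restrict_graph {ω : Set (EuclideanSpace ℝ (Fin n))} (hω : IsOpen ω)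
    {φ : EuclideanSpace ℝ (Fin n) → ℝ} (hφ : ContDiffOn ℝ 1 φ ω) :
    (μHE[n].restrict (graph ω φ)).map base =
      (volume.restrict ω).withDensity fun y => (areaDensity φ y : ENNReal) := by
  set μ := (μHE[n].restrict (graph ω φ)).map base with hμ
  set ν := (volume : Measure (EuclideanSpace ℝ (Fin n))).withDensity
    fun y => (areaDensity φ y : ENNReal) with hν
  have hμω : μ.restrict ω = μ := by
    refine Measure.restrict_eq_self_of_ae_mem ?_
    rw [hμ]
    refine (ae_map_iff continuous_base.measurable.aemeasurable hω.measurableSet).2 ?_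
    filter_upwards [ae_restrict_mem (measurableSet_graph hω hφ.continuousOn)] with x hx using hx.1
  rw [← restrict_withDensity hω.measurableSet, ← hν, ← hμω]
  have hνA : ∀ A, MeasurableSet A → ν A = ∫⁻ y in A, areaDensity φ y := fun A hA =>
    withDensity_apply _ hA
  -- The exponent `n + 1` collects `n` factors from scaling the `n`-dimensional measure and one from
  -- freezing the density at `p`.
  have hloc : ∀ δ : NNReal, 0 < δ → ∀ p ∈ ω, ∃ s ∈ 𝓝 p, ∀ A, MeasurableSet A → A ⊆ ω → A ⊆ s →
      μ A ≤ ((1 + δ : NNReal) ^ (n + 1) : ENNReal) * ν A ∧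
      ν A ≤ ((1 + δ : NNReal) ^ (n + 1) : ENNReal) * μ A := by
    intro δ hδ p hp
    have hp' := hφ.contDiffAt (hω.mem_nhds hp)
    obtain ⟨s, hs, h1⟩ := exists_nhds_area_compare hp' hδ
    obtain ⟨t, ht, h2⟩ := exists_nhds_density_compare hp' hδ
    refine ⟨s ∩ t, inter_mem hs ht, fun A hA hAω hAst => ?_⟩
    obtain ⟨a1, a2⟩ := h1 A (hAst.trans inter_subset_left)
    obtain ⟨b1, b2⟩ := h2 A (hAst.trans inter_subset_right) hA
    rw [hμ, map_base_restrict_graph_apply hA hAω, hνA A hA]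
    constructor
    · calc _ ≤ _ := a1
        _ ≤ _ := mul_le_mul_right b2 _
        _ = _ := by rw [pow_succ, mul_assoc]
    · calc _ ≤ _ := b1
        _ ≤ _ := mul_le_mul_right a2 _
        _ = _ := by rw [pow_succ', mul_assoc]
  refine le_antisymm (measure_le_of_forall_le_mul (n + 1) fun δ hδ => ?_)
    (measure_le_of_forall_le_mul (n + 1) fun δ hδ => ?_)
  · rw [← Measure.restrict_smul]
    refine le_restrict_of_locally_le hω.measurableSet fun p hp => ?_
    obtain ⟨s, hs, h⟩ := hloc δ hδ p hp
    exact ⟨s, hs, fun A hA hAω hAs => (h A hA hAω hAs).1⟩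
  · rw [← Measure.restrict_smul]
    refine le_restrict_of_locally_le hω.measurableSet fun p hp => ?_
    obtain ⟨s, hs, h⟩ := hloc δ hδ p hp
    exact ⟨s, hs, fun A hA hAω hAs => (h A hA hAω hAs).2⟩

theorem integrableOn_graph_comp_base_iff {ω : Set (EuclideanSpace ℝ (Fin n))} (hω : IsOpen ω)
    {φ : EuclideanSpace ℝ (Fin n) → ℝ} (hφ : ContDiffOn ℝ 1 φ ω)
    {h : EuclideanSpace ℝ (Fin n) → ℝ} (hh : AEStronglyMeasurable h (volume.restrict ω)) :
    IntegrableOn (fun x => h (base x)) (graph ω φ) μHE[n] ↔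
      IntegrableOn (fun y => √(1 + ‖gradient φ y‖ ^ 2) * h y) ω := by
  have hh' : AEStronglyMeasurable h ((μHE[n].restrict (graph ω φ)).map base) := by
    rw [map_base_restrict_graph hω hφ]
    exact hh.mono_ac (withDensity_absolutelyContinuous _ _)
  have := integrable_map_measure hh' continuous_base.measurable.aemeasurable
  rw [IntegrableOn, IntegrableOn]
  refine this.symm.trans ?_
  rw [map_base_restrict_graph hω hφ,
    integrable_withDensity_iff_integrable_smul (measurable_areaDensity φ)]
  simp [NNReal.smul_def, coe_areaDensity]

theorem setIntegral_graph_comp_base {ω : Set (EuclideanSpace ℝ (Fin n))} (hω : IsOpen ω)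
    {φ : EuclideanSpace ℝ (Fin n) → ℝ} (hφ : ContDiffOn ℝ 1 φ ω)
    {h : EuclideanSpace ℝ (Fin n) → ℝ} (hh : AEStronglyMeasurable h (volume.restrict ω)) :
    ∫ x in graph ω φ, h (base x) ∂μHE[n] = ∫ y in ω, √(1 + ‖gradient φ y‖ ^ 2) * h y := by
  have hh' : AEStronglyMeasurable h ((μHE[n].restrict (graph ω φ)).map base) := by
    rw [map_base_restrict_graph hω hφ]
    exact hh.mono_ac (withDensity_absolutelyContinuous _ _)
  rw [← integral_map continuous_base.measurable.aemeasurable hh', map_base_restrict_graph hω hφ,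
    integral_withDensity_eq_integral_smul (measurable_areaDensity φ)]
  simp [NNReal.smul_def, coe_areaDensity]

end AreaFormula

/-! ### Normals of the graph and of the cylinder. -/

section Normals

variable {n : ℕ}

/-- `base` as a continuous linear map. -/
def baseCLM : EuclideanSpace ℝ (Fin (n + 1)) →L[ℝ] EuclideanSpace ℝ (Fin n) where
  toFun := base
  map_add' x y := by ext i; simp [base]
  map_smul' c x := by ext i; simp [base]
  cont := continuous_base

@[simp]
theorem baseCLM_apply (x : EuclideanSpace ℝ (Fin (n + 1))) : baseCLM x = base x := rfl

@[simp]
theorem height_smul (c : ℝ) (x : EuclideanSpace ℝ (Fin (n + 1))) :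
    height (c • x) = c * height x := rfl

@[simp]
theorem height_add (x y : EuclideanSpace ℝ (Fin (n + 1))) :
    height (x + y) = height x + height y := rfl

/-- The inclusion `x' ↦ (x', 0)` as a continuous linear map. -/
def horizontal : EuclideanSpace ℝ (Fin n) →L[ℝ] EuclideanSpace ℝ (Fin (n + 1)) :=
  LinearMap.toContinuousLinearMap
    { toFun := graphMap fun _ => 0
      map_add' := fun x y => by
        refine ext_base_height ?_ ?_
        · rw [← baseCLM_apply, ← baseCLM_apply, map_add]; simp
        · rw [height_add]; simp
      map_smul' := fun c x => by
        refine ext_base_height ?_ ?_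
        · rw [← baseCLM_apply, ← baseCLM_apply, map_smul]; simp
        · rw [height_smul]; simp }

@[simp]
theorem base_horizontal (v : EuclideanSpace ℝ (Fin n)) : base (horizontal v) = v :=
  base_graphMap (fun _ => 0) v

@[simp]
theorem height_horizontal (v : EuclideanSpace ℝ (Fin n)) : height (horizontal v) = 0 :=
  height_graphMap (fun _ => 0) v

@[simp]
theorem base_eLast : base (eLast (n := n)) = 0 := by
  ext i; simp [base, eLast]

@[simp]
theorem height_eLast : height (eLast (n := n)) = 1 := by simp [height, eLast]

@[simp]
theorem base_add (x y : EuclideanSpace ℝ (Fin (n + 1))) : base (x + y) = base x + base y :=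
  map_add baseCLM x y

@[simp]
theorem base_sub (x y : EuclideanSpace ℝ (Fin (n + 1))) : base (x - y) = base x - base y :=
  map_sub baseCLM x y

@[simp]
theorem base_smul (c : ℝ) (x : EuclideanSpace ℝ (Fin (n + 1))) : base (c • x) = c • base x :=
  map_smul baseCLM c x

@[simp]
theorem height_sub (x y : EuclideanSpace ℝ (Fin (n + 1))) :
    height (x - y) = height x - height y := rfl

theorem inner_eq_base_add_height (x y : EuclideanSpace ℝ (Fin (n + 1))) :
    ⟪x, y⟫ = ⟪base x, base y⟫ + height x * height y := by
  simp [PiLp.inner_apply, Fin.sum_univ_castSucc, base, height, mul_comm]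

theorem graphMap_eq (φ : EuclideanSpace ℝ (Fin n) → ℝ) (y : EuclideanSpace ℝ (Fin n)) :
    graphMap φ y = horizontal y + φ y • eLast := by
  refine ext_base_height ?_ ?_
  · simp
  · simp

theorem hasGradientAt_height (x : EuclideanSpace ℝ (Fin (n + 1))) :
    HasGradientAt height eLast x := by
  have h : (height : EuclideanSpace ℝ (Fin (n + 1)) → ℝ) =
      InnerProductSpace.toDual ℝ _ (eLast (n := n)) := by
    ext y; simp [inner_eq_base_add_height]
  rw [hasGradientAt_iff_hasFDerivAt, h]
  exact ContinuousLinearMap.hasFDerivAt _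

theorem hasGradientAt_comp_base {f : EuclideanSpace ℝ (Fin n) → ℝ}
    {x : EuclideanSpace ℝ (Fin (n + 1))} (hf : DifferentiableAt ℝ f (base x)) :
    HasGradientAt (fun z => f (base z)) (horizontal (gradient f (base x))) x := by
  rw [hasGradientAt_iff_hasFDerivAt]
  refine (hf.hasFDerivAt.comp x (baseCLM (n := n)).hasFDerivAt).congr_fderiv ?_
  ext v
  simp [inner_eq_base_add_height]

/-- The upward unit normal `(-v, 1) / √(1 + |v|²)` of a hyperplane with slope `v`. -/
def slopeNormal (v : EuclideanSpace ℝ (Fin n)) : EuclideanSpace ℝ (Fin (n + 1)) :=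
  (√(1 + ‖v‖ ^ 2))⁻¹ • (eLast - horizontal v)

theorem norm_eLast_sub_horizontal (v : EuclideanSpace ℝ (Fin n)) :
    ‖eLast - horizontal v‖ = √(1 + ‖v‖ ^ 2) := by
  rw [← Real.sqrt_sq (norm_nonneg (eLast - horizontal v)), norm_sq_eq_base_add_height]
  simp [add_comm]

theorem continuous_slopeNormal : Continuous (slopeNormal (n := n)) := by
  have : ∀ v : EuclideanSpace ℝ (Fin n), √(1 + ‖v‖ ^ 2) ≠ 0 := fun v => by positivity
  unfold slopeNormal
  fun_prop (disch := assumption)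

theorem isOpen_cylinder {ω : Set (EuclideanSpace ℝ (Fin n))} (hω : IsOpen ω) :
    IsOpen (cylinder ω) :=
  (hω.preimage continuous_base).inter (isOpen_lt continuous_const continuous_height)

/-- Inside the open cylinder the subgraph is `{x_N - φ(x') < 0}`, which provides the defining
function. -/
theorem outerUnitNormal_subgraph {ω : Set (EuclideanSpace ℝ (Fin n))} (hω : IsOpen ω)
    {φ : EuclideanSpace ℝ (Fin n) → ℝ} (hφ : ContDiffOn ℝ 1 φ ω) (hpos : ∀ y ∈ ω, 0 < φ y)
    {x : EuclideanSpace ℝ (Fin (n + 1))} (hx : x ∈ graph ω φ) :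
    outerUnitNormal (subgraph ω φ) x = slopeNormal (gradient φ (base x)) := by
  have hd : DifferentiableAt ℝ φ (base x) :=
    (hφ.contDiffAt (hω.mem_nhds hx.1)).differentiableAt one_ne_zero
  have hg : HasGradientAt (fun z => height z - φ (base z))
      (eLast - horizontal (gradient φ (base x))) x := by
    rw [hasGradientAt_iff_hasFDerivAt, map_sub]
    exact (hasGradientAt_height x).hasFDerivAt.sub (hasGradientAt_comp_base hd).hasFDerivAt
  have hh : ContDiff ℝ 1 (height (n := n)) := by unfold height; fun_prop
  refine outerUnitNormal_eq ⟨fun z => height z - φ (base z),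
    ⟨cylinder ω, isOpen_cylinder hω, ⟨hx.1, ?_⟩, ?_, ?_, ?_, ?_⟩, ?_⟩
  · rw [hx.2]; exact hpos _ hx.1
  · exact hh.contDiffOn.sub (hφ.comp (baseCLM (n := n)).contDiff.contDiffOn fun z hz => hz.1)
  · intro z hz
    simp [subgraph, hz]
  · simp [hx.2]
  · rw [hg.gradient]
    intro h
    have := norm_eLast_sub_horizontal (gradient φ (base x))
    rw [h, norm_zero] at this
    have h2 : 0 < √(1 + ‖gradient φ (base x)‖ ^ 2) := by positivity
    linarith
  · rw [hg.gradient, norm_eLast_sub_horizontal]; rfl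

/-- Over `∂ω` the limit of the normals is governed by the extension `G`, not by `gradient φ`, whose
value there depends on `φ` outside `closure ω`. -/
theorem graphNormal_eq {ω : Set (EuclideanSpace ℝ (Fin n))} (hω : IsOpen ω)
    {φ : EuclideanSpace ℝ (Fin n) → ℝ} (hφ : ContDiffOn ℝ 1 φ ω) (hpos : ∀ y ∈ ω, 0 < φ y)
    {G : EuclideanSpace ℝ (Fin n) → EuclideanSpace ℝ (Fin n)} (hG : ContinuousOn G (closure ω))
    (hGφ : ∀ y ∈ ω, G y = gradient φ y) {x : EuclideanSpace ℝ (Fin (n + 1))}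
    (hx : x ∈ closure (graph ω φ)) :
    graphNormal ω φ x = slopeNormal (G (base x)) := by
  have hmaps : MapsTo base (graph ω φ) (closure ω) := fun z hz => subset_closure hz.1
  have hbx : base x ∈ closure ω :=
    map_mem_closure continuous_base hx fun z hz => hz.1
  refine extendFrom_eq hx ?_
  have h1 : Tendsto (fun z => slopeNormal (G (base z))) (𝓝[graph ω φ] x)
      (𝓝 (slopeNormal (G (base x)))) :=
    (continuous_slopeNormal.tendsto _).comp
      ((hG (base x) hbx).tendsto.comp
        (continuous_base.continuousWithinAt.tendsto_nhdsWithin hmaps))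
  refine h1.congr' ?_
  filter_upwards [self_mem_nhdsWithin] with z hz
  rw [outerUnitNormal_subgraph hω hφ hpos hz, hGφ _ hz.1]

theorem graphMap_mem_closure_graph {ω : Set (EuclideanSpace ℝ (Fin n))}
    {φ : EuclideanSpace ℝ (Fin n) → ℝ} (hφ : ContinuousOn φ (closure ω))
    {p : EuclideanSpace ℝ (Fin n)} (hp : p ∈ closure ω) :
    graphMap φ p ∈ closure (graph ω φ) := by
  have h : ContinuousWithinAt (graphMap φ) ω p := by
    have h1 : ContinuousWithinAt φ ω p := (hφ p hp).mono subset_closure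
    have h2 : graphMap φ = fun y => horizontal y + φ y • eLast := funext (graphMap_eq φ)
    rw [h2]
    fun_prop
  exact h.mem_closure hp fun y hy => graphMap_mem_graph φ hy

/-- At positive height a defining function of `ω`, composed with the projection, defines the
cylinder; its gradient is horizontal. -/
theorem outerUnitNormal_cylinder {ω : Set (EuclideanSpace ℝ (Fin n))}
    {x : EuclideanSpace ℝ (Fin (n + 1))} (hx : 0 < height x) {g : EuclideanSpace ℝ (Fin n) → ℝ}
    (hg : IsLocalDefiningFunction 1 ω (base x) g) :
    outerUnitNormal (cylinder ω) x =
      ‖gradient g (base x)‖⁻¹ • horizontal (gradient g (base x)) := by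
  obtain ⟨U, hU, hpU, hgU, hgω, h0, hne⟩ := hg
  have hd : DifferentiableAt ℝ g (base x) :=
    (hgU.contDiffAt (hU.mem_nhds hpU)).differentiableAt (by simp)
  have hgr := (hasGradientAt_comp_base hd).gradient
  have hnorm : ‖horizontal (gradient g (base x))‖ = ‖gradient g (base x)‖ := by
    rw [← sq_eq_sq₀ (norm_nonneg _) (norm_nonneg _), norm_sq_eq_base_add_height]
    simp
  refine outerUnitNormal_eq ⟨fun z => g (base z), ⟨cylinder U, isOpen_cylinder hU, ⟨hpU, hx⟩,
    ?_, ?_, h0, ?_⟩, ?_⟩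
  · exact hgU.comp (baseCLM (n := n)).contDiff.contDiffOn fun z hz => hz.1
  · intro z hz
    simp [cylinder, hz.2, hgω _ hz.1]
  · rw [hgr, ← norm_ne_zero_iff, hnorm]
    exact norm_ne_zero_iff.2 hne
  · rw [hgr, hnorm]

/-- If the graph meets the lateral boundary orthogonally, the gradient is tangential at the
boundary. -/
theorem MeetsOrthogonally.inner_gradient_eq_zero {ω : Set (EuclideanSpace ℝ (Fin n))}
    (hω : IsOpen ω) {φ : EuclideanSpace ℝ (Fin n) → ℝ} (hφ : ContDiffOn ℝ 1 φ ω)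
    (hφc : ContinuousOn φ (closure ω)) (hpos : ∀ y ∈ closure ω, 0 < φ y)
    (horth : MeetsOrthogonally ω φ)
    {G : EuclideanSpace ℝ (Fin n) → EuclideanSpace ℝ (Fin n)} (hG : ContinuousOn G (closure ω))
    (hGφ : ∀ y ∈ ω, G y = gradient φ y) {p : EuclideanSpace ℝ (Fin n)} (hp : p ∈ frontier ω)
    {g : EuclideanSpace ℝ (Fin n) → ℝ} (hg : IsLocalDefiningFunction 1 ω p g) :
    ⟪gradient g p, G p⟫ = 0 := by
  have hp' : p ∈ closure ω ∧ p ∉ ω := by rwa [hω.frontier_eq] at hp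
  have hx := graphMap_mem_closure_graph hφc hp'.1
  have hh : 0 < height (graphMap φ p) := by simpa using hpos p hp'.1
  -- Positivity of `φ` on the closure places the whole edge of the graph on the lateral boundary, so
  -- orthogonality applies above every `p ∈ ∂ω`.
  have hlat : graphMap φ p ∈ lateralBoundary ω := by
    refine ⟨?_, hh⟩
    rw [(isOpen_cylinder hω).frontier_eq]
    refine ⟨?_, fun h => hp'.2 (by simpa using h.1)⟩
    have hsub : graph ω φ ⊆ cylinder ω := fun z hz =>
      ⟨hz.1, by rw [hz.2]; exact hpos _ (subset_closure hz.1)⟩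
    exact closure_mono hsub hx
  have h := horth _ ⟨hx, hlat⟩
  rw [graphNormal_eq hω hφ (fun y hy => hpos y (subset_closure hy)) hG hGφ hx,
    outerUnitNormal_cylinder hh (g := g) (by simpa using hg)] at h
  have hne : gradient g p ≠ 0 := by
    obtain ⟨U, -, -, -, -, -, h⟩ := hg
    exact h
  have hne' : √(1 + ‖G p‖ ^ 2) ≠ 0 := by positivity
  simp only [slopeNormal, base_graphMap, inner_smul_left, inner_smul_right,
    inner_eq_base_add_height, base_sub, base_eLast, base_horizontal, height_sub,
    height_horizontal, zero_sub, inner_neg_left] at h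
  simpa [hne, hne', real_inner_comm] using h

end Normals

/-! ### The mean curvature of a graph in divergence form. -/

section Curvature

variable {n : ℕ}

/-- The Hessian matrix of `φ`. -/
def hessian (φ : EuclideanSpace ℝ (Fin n) → ℝ) (y : EuclideanSpace ℝ (Fin n)) :
    Matrix (Fin n) (Fin n) ℝ :=
  Matrix.of fun i j =>
    fderiv ℝ (fderiv ℝ φ) y (EuclideanSpace.single i 1) (EuclideanSpace.single j 1)

/-- The expression for `div (v / √(1 + |v|²))` in terms of the values of `v` and of its
derivative `h`. -/
def curvatureTerm (v : EuclideanSpace ℝ (Fin n)) (h : Matrix (Fin n) (Fin n) ℝ) : ℝ :=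
  (√(1 + ‖v‖ ^ 2))⁻¹ * (∑ i, h i i) -
    (√(1 + ‖v‖ ^ 2))⁻¹ ^ 3 * ∑ i, ∑ j, v i * v j * h i j

theorem gradient_apply (φ : EuclideanSpace ℝ (Fin n) → ℝ) (y : EuclideanSpace ℝ (Fin n))
    (i : Fin n) : gradient φ y i = fderiv ℝ φ y (EuclideanSpace.single i 1) := by
  rw [← inner_gradient_left, EuclideanSpace.inner_single_right]
  simp

theorem contDiffOn_gradient {ω : Set (EuclideanSpace ℝ (Fin n))} (hω : IsOpen ω)
    {φ : EuclideanSpace ℝ (Fin n) → ℝ} (hφ : ContDiffOn ℝ 2 φ ω) :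
    ContDiffOn ℝ 1 (gradient φ) ω :=
  (InnerProductSpace.toDual ℝ (EuclideanSpace ℝ (Fin n))).symm.contDiff.comp_contDiffOn
    (hφ.fderiv_of_isOpen hω (by norm_num))

theorem fderiv_gradient_apply {φ : EuclideanSpace ℝ (Fin n) → ℝ} {y : EuclideanSpace ℝ (Fin n)}
    (hφ : DifferentiableAt ℝ (fderiv ℝ φ) y) (v w : EuclideanSpace ℝ (Fin n)) :
    ⟪fderiv ℝ (gradient φ) y v, w⟫ = fderiv ℝ (fderiv ℝ φ) y v w := by
  have h := ((InnerProductSpace.toDual ℝ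
    (EuclideanSpace ℝ (Fin n))).symm.toContinuousLinearEquiv.hasFDerivAt).comp y hφ.hasFDerivAt
  have h' : HasFDerivAt (gradient φ) _ y := h
  rw [h'.fderiv]
  exact InnerProductSpace.toDual_symm_apply

theorem hasFDerivAt_inv_sqrt_one_add_norm_sq
    {G : EuclideanSpace ℝ (Fin n) → EuclideanSpace ℝ (Fin n)} {y : EuclideanSpace ℝ (Fin n)}
    (hG : DifferentiableAt ℝ G y) :
    HasFDerivAt (fun x => (√(1 + ‖G x‖ ^ 2))⁻¹)
      (-((√(1 + ‖G y‖ ^ 2))⁻¹ ^ 3) • (innerSL ℝ (G y)).comp (fderiv ℝ G y)) y := by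
  have h1 := (hG.hasFDerivAt.norm_sq).const_add 1
  have hpos : 0 < √(1 + ‖G y‖ ^ 2) := by positivity
  have h2 := (hasDerivAt_inv hpos.ne').comp_hasFDerivAt y (h1.sqrt (by positivity))
  refine h2.congr_fderiv ?_
  ext v
  simp
  field_simp

/-- The product rule, with `d(1/W) = -W⁻³ ⟨∇φ, D∇φ ·⟩` producing the cubic term. -/
theorem divergence_inv_sqrt_smul {φ : EuclideanSpace ℝ (Fin n) → ℝ}
    {y : EuclideanSpace ℝ (Fin n)} (hφ : DifferentiableAt ℝ (fderiv ℝ φ) y)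
    (hG : DifferentiableAt ℝ (gradient φ) y) :
    divergence (fun x => (√(1 + ‖gradient φ x‖ ^ 2))⁻¹ • gradient φ x) y =
      curvatureTerm (gradient φ y) (hessian φ y) := by
  have ha := hasFDerivAt_inv_sqrt_one_add_norm_sq hG
  rw [divergence_smul ha.differentiableAt hG, ha.fderiv]
  have h1 : divergence (gradient φ) y = ∑ i, hessian φ y i i := by
    refine Finset.sum_congr rfl fun i _ => ?_
    rw [hessian, Matrix.of_apply, ← fderiv_gradient_apply hφ,
      EuclideanSpace.inner_single_right]
    simp [partialDeriv]
  have h2 : ⟪gradient φ y, fderiv ℝ (gradient φ) y (gradient φ y)⟫ =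
      ∑ i, ∑ j, gradient φ y i * gradient φ y j * hessian φ y i j := by
    rw [real_inner_comm, fderiv_gradient_apply hφ]
    conv_lhs => rw [← euclidean_sum_smul_single (gradient φ y)]
    simp only [map_sum, map_smul, _root_.sum_apply, _root_.smul_apply, smul_eq_mul,
      Finset.mul_sum, hessian, Matrix.of_apply, mul_assoc]
    rw [Finset.sum_comm]
    refine Finset.sum_congr rfl fun i _ => Finset.sum_congr rfl fun j _ => ?_
    ring
  rw [h1]
  simp only [_root_.smul_apply, ContinuousLinearMap.comp_apply, innerSL_apply_apply,
    smul_eq_mul, h2, curvatureTerm]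
  ring

theorem partialDeriv_graphMap {φ : EuclideanSpace ℝ (Fin n) → ℝ} {y : EuclideanSpace ℝ (Fin n)}
    (hφ : DifferentiableAt ℝ φ y) (i : Fin n) :
    partialDeriv i (graphMap φ) y =
      horizontal (EuclideanSpace.single i 1) + gradient φ y i • eLast := by
  have h2 : graphMap φ = fun y => horizontal y + φ y • eLast := funext (graphMap_eq φ)
  have h : HasFDerivAt (graphMap φ) (horizontal + (fderiv ℝ φ y).smulRight eLast) y := by
    rw [h2]
    exact horizontal.hasFDerivAt.add (hφ.hasFDerivAt.smul_const eLast)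
  rw [partialDeriv, h.fderiv, gradient_apply]
  rfl

theorem firstFundamentalForm_graphMap {φ : EuclideanSpace ℝ (Fin n) → ℝ}
    {y : EuclideanSpace ℝ (Fin n)} (hφ : DifferentiableAt ℝ φ y) :
    firstFundamentalForm (graphMap φ) y =
      1 + Matrix.vecMulVec (gradient φ y).ofLp (gradient φ y).ofLp := by
  ext i j
  simp only [firstFundamentalForm, partialDeriv_graphMap hφ, inner_eq_base_add_height, base_add,
    base_smul, base_eLast, base_horizontal, height_add, height_smul, height_eLast,
    height_horizontal, smul_zero, add_zero, EuclideanSpace.inner_single_right]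
  simp [Matrix.vecMulVec_apply, Matrix.one_apply, PiLp.single_apply, eq_comm]

/-- The second derivatives of the graph map are vertical, so only the last component `1 / W` of the
normal contributes. -/
theorem secondFundamentalForm_graphMap {ω : Set (EuclideanSpace ℝ (Fin n))} (hω : IsOpen ω)
    {φ : EuclideanSpace ℝ (Fin n) → ℝ} (hφ : ContDiffOn ℝ 2 φ ω) {y : EuclideanSpace ℝ (Fin n)}
    (hy : y ∈ ω) (v : EuclideanSpace ℝ (Fin n)) :
    secondFundamentalForm (graphMap φ) (slopeNormal v) y =
      -(√(1 + ‖v‖ ^ 2))⁻¹ • hessian φ y := by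
  have hd : DifferentiableAt ℝ (fderiv ℝ φ) y :=
    ((hφ.fderiv_of_isOpen hω (m := 1) (by norm_num)).contDiffAt
      (hω.mem_nhds hy)).differentiableAt one_ne_zero
  ext i j
  have h1 : partialDeriv j (graphMap φ) =ᶠ[𝓝 y] fun x =>
      horizontal (EuclideanSpace.single j 1) +
        fderiv ℝ φ x (EuclideanSpace.single j 1) • eLast := by
    filter_upwards [hω.mem_nhds hy] with x hx
    rw [partialDeriv_graphMap ((hφ.contDiffAt (hω.mem_nhds hx)).differentiableAt two_ne_zero),
      gradient_apply]
  have h2 : partialDeriv i (partialDeriv j (graphMap φ)) y = hessian φ y i j • eLast := by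
    rw [partialDeriv, h1.fderiv_eq]
    have h3 := ((hd.hasFDerivAt.clm_apply (hasFDerivAt_const
      (EuclideanSpace.single j (1 : ℝ)) y)).smul_const (eLast (n := n))).const_add
        (horizontal (EuclideanSpace.single j (1 : ℝ)))
    rw [h3.fderiv]
    simp [hessian]
  rw [secondFundamentalForm, Matrix.of_apply, h2]
  simp [slopeNormal, inner_eq_base_add_height, mul_comm]

theorem meanCurvature_graphMap {ω : Set (EuclideanSpace ℝ (Fin n))} (hω : IsOpen ω)
    {φ : EuclideanSpace ℝ (Fin n) → ℝ} (hφ : ContDiffOn ℝ 2 φ ω) {y : EuclideanSpace ℝ (Fin n)}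
    (hy : y ∈ ω) :
    meanCurvature (graphMap φ) (slopeNormal (gradient φ y)) y =
      -(1 / (n : ℝ)) * curvatureTerm (gradient φ y) (hessian φ y) := by
  have hd := (hφ.contDiffAt (hω.mem_nhds hy)).differentiableAt two_ne_zero
  rw [meanCurvature, firstFundamentalForm_graphMap hd, secondFundamentalForm_graphMap hω hφ hy]
  set v := gradient φ y with hv
  have hW := sq_sqrt_one_add_norm_sq v
  have hpos : 0 < √(1 + ‖v‖ ^ 2) := by positivity
  set W := √(1 + ‖v‖ ^ 2) with hWdef
  have hdot : v.ofLp ⬝ᵥ v.ofLp = W ^ 2 - 1 := by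
    rw [hW, EuclideanSpace.norm_sq_eq]
    simp [dotProduct, sq]
  -- The Sherman–Morrison formula, with `1 + v·v = W²`.
  have hinv : (1 + Matrix.vecMulVec v.ofLp v.ofLp)⁻¹ =
      1 - (W⁻¹ ^ 2) • Matrix.vecMulVec v.ofLp v.ofLp := by
    refine Matrix.inv_eq_right_inv ?_
    have hsq : Matrix.vecMulVec v.ofLp v.ofLp * Matrix.vecMulVec v.ofLp v.ofLp =
        (W ^ 2 - 1) • Matrix.vecMulVec v.ofLp v.ofLp := by
      rw [Matrix.vecMulVec_mul_vecMulVec, hdot]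
      ext i j
      simp only [Matrix.vecMulVec_apply, Matrix.smul_apply, Pi.smul_apply, smul_eq_mul]
      ring
    rw [add_mul, one_mul, mul_sub, mul_one, mul_smul_comm, hsq, smul_smul]
    ext i j
    simp only [Matrix.add_apply, Matrix.sub_apply, Matrix.smul_apply, smul_eq_mul]
    field_simp
    ring
  have htr : (Matrix.vecMulVec v.ofLp v.ofLp * hessian φ y).trace =
      ∑ i, ∑ j, v i * v j * hessian φ y i j := by
    simp only [Matrix.trace, Matrix.diag_apply, Matrix.mul_apply, Matrix.vecMulVec_apply]
    rw [Finset.sum_comm]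
    refine Finset.sum_congr rfl fun i _ => Finset.sum_congr rfl fun j _ => ?_
    ring
  have htr' : (hessian φ y).trace = ∑ i, hessian φ y i i := rfl
  rw [hinv, mul_smul_comm, Matrix.trace_smul, sub_mul, one_mul, Matrix.trace_sub, smul_mul_assoc,
    Matrix.trace_smul, htr, htr', curvatureTerm]
  simp only [smul_eq_mul]
  ring

end Curvature

/-! ### Continuous extension of the derivatives to the closure. -/

section Extension

variable {n : ℕ}

theorem ContDiffUpToBoundary.exists_gradient_extension {ω : Set (EuclideanSpace ℝ (Fin n))}
    {φ : EuclideanSpace ℝ (Fin n) → ℝ} (hφ : ContDiffUpToBoundary 2 φ ω) :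
    ∃ G : EuclideanSpace ℝ (Fin n) → EuclideanSpace ℝ (Fin n),
      ContinuousOn G (closure ω) ∧ ∀ y ∈ ω, G y = gradient φ y := by
  obtain ⟨T, hT, hTφ⟩ := hφ.2.2 1 (by norm_num)
  refine ⟨fun y => WithLp.toLp 2 fun i => T y fun _ => EuclideanSpace.single i 1, ?_,
    fun y hy => ?_⟩
  · have h : ∀ i, ContinuousOn (fun y => T y fun _ => EuclideanSpace.single i 1) (closure ω) :=
      fun i => (continuous_eval_const _).comp_continuousOn hT
    fun_prop
  · ext i
    rw [gradient_apply]
    simp [hTφ hy, iteratedFDeriv_one_apply]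

theorem ContDiffUpToBoundary.exists_hessian_extension {ω : Set (EuclideanSpace ℝ (Fin n))}
    {φ : EuclideanSpace ℝ (Fin n) → ℝ} (hφ : ContDiffUpToBoundary 2 φ ω) :
    ∃ H : EuclideanSpace ℝ (Fin n) → Matrix (Fin n) (Fin n) ℝ,
      ContinuousOn H (closure ω) ∧ ∀ y ∈ ω, H y = hessian φ y := by
  obtain ⟨T, hT, hTφ⟩ := hφ.2.2 2 le_rfl
  refine ⟨fun y => Matrix.of fun i j =>
    T y ![EuclideanSpace.single i 1, EuclideanSpace.single j 1], ?_, fun y hy => ?_⟩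
  · refine continuousOn_pi.2 fun i => continuousOn_pi.2 fun j => ?_
    exact (continuous_eval_const _).comp_continuousOn hT
  · ext i j
    simp [hTφ hy, iteratedFDeriv_two_apply, hessian]

theorem continuousOn_curvatureTerm {s : Set (EuclideanSpace ℝ (Fin n))}
    {G : EuclideanSpace ℝ (Fin n) → EuclideanSpace ℝ (Fin n)}
    {H : EuclideanSpace ℝ (Fin n) → Matrix (Fin n) (Fin n) ℝ} (hG : ContinuousOn G s)
    (hH : ContinuousOn H s) : ContinuousOn (fun y => curvatureTerm (G y) (H y)) s := by
  have h1 : ∀ y, √(1 + ‖G y‖ ^ 2) ≠ 0 := fun y => by positivity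
  have h2 : ∀ i j, ContinuousOn (fun y => H y i j) s := fun i j =>
    continuousOn_pi.1 (continuousOn_pi.1 hH i) j
  have h3 : ContinuousOn (fun y => (√(1 + ‖G y‖ ^ 2))⁻¹) s :=
    ContinuousOn.inv₀ (by fun_prop) fun y _ => h1 y
  unfold curvatureTerm
  fun_prop

end Extension

end CylinderGraph

end

/-! ### The integral identity. -/

open CylinderGraph in
theorem proposition2p2 (n : ℕ) (hn : 1 ≤ n)
    (ω : Set (EuclideanSpace ℝ (Fin n))) (hω : CylinderGraph.IsSmoothBoundedDomain ω)
    (φ : EuclideanSpace ℝ (Fin n) → ℝ) (hφ : CylinderGraph.ContDiffUpToBoundary 2 φ ω)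
    (hpos : ∀ y ∈ closure ω, 0 < φ y)
    (horth : CylinderGraph.MeetsOrthogonally ω φ) :
    IntegrableOn
      (fun x => CylinderGraph.graphMeanCurvature ω φ x *
        ⟪CylinderGraph.height x • CylinderGraph.eLast, CylinderGraph.graphNormal ω φ x⟫)
      (CylinderGraph.graph ω φ) μHE[n] ∧
    IntegrableOn (fun y => ‖gradient φ y‖ ^ 2 / Real.sqrt (1 + ‖gradient φ y‖ ^ 2)) ω volume ∧
    ∫ x in CylinderGraph.graph ω φ, CylinderGraph.graphMeanCurvature ω φ x *
        ⟪CylinderGraph.height x • CylinderGraph.eLast, CylinderGraph.graphNormal ω φ x⟫ ∂μHE[n] =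
      (1 / (n : ℝ)) *
        ∫ y in ω, ‖gradient φ y‖ ^ 2 / Real.sqrt (1 + ‖gradient φ y‖ ^ 2) := by
  have hωo := hω.isOpen
  have hωm := hωo.measurableSet
  have hK : IsCompact (closure ω) := hω.isBounded.isCompact_closure
  have hφ2 : ContDiffOn ℝ 2 φ ω := hφ.1
  have hφ1 : ContDiffOn ℝ 1 φ ω := hφ2.of_le one_le_two
  have hφc := hφ.2.1
  have hposω : ∀ y ∈ ω, 0 < φ y := fun y hy => hpos y (subset_closure hy)
  obtain ⟨G, hG, hGφ⟩ := hφ.exists_gradient_extension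
  obtain ⟨H, hH, hHφ⟩ := hφ.exists_hessian_extension
  -- All absolute convergence comes from here: every integrand on `ω` agrees there with a continuous
  -- function on the compact closure.
  have hintK : ∀ {f : EuclideanSpace ℝ (Fin n) → ℝ}, ContinuousOn f (closure ω) →
      IntegrableOn f ω := fun hf => (hf.integrableOn_compact hK).mono_set subset_closure
  have hW0 : ∀ y, √(1 + ‖G y‖ ^ 2) ≠ 0 := fun y => by positivity
  have hWc : ContinuousOn (fun y => (√(1 + ‖G y‖ ^ 2))⁻¹) (closure ω) :=
    ContinuousOn.inv₀ (by fun_prop) fun y _ => hW0 y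
  have hDc := continuousOn_curvatureTerm hG hH
  have hQ : IntegrableOn (fun y => ‖gradient φ y‖ ^ 2 / √(1 + ‖gradient φ y‖ ^ 2)) ω := by
    have h1 : ContinuousOn (fun y => ‖G y‖ ^ 2 * (√(1 + ‖G y‖ ^ 2))⁻¹) (closure ω) := by fun_prop
    refine (hintK h1).congr_fun (fun y hy => ?_) hωm
    simp only [hGφ y hy, div_eq_mul_inv]
  have hφD : IntegrableOn (fun y => φ y * curvatureTerm (gradient φ y) (hessian φ y)) ω := by
    refine (hintK (hφc.mul hDc)).congr_fun (fun y hy => ?_) hωm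
    rw [← hGφ y hy, ← hHφ y hy]
    rfl
  -- the divergence theorem for `φ ∇φ / √(1 + |∇φ|²)`
  have hparts : ∫ y in ω, φ y * curvatureTerm (gradient φ y) (hessian φ y) =
      -∫ y in ω, ‖gradient φ y‖ ^ 2 / √(1 + ‖gradient φ y‖ ^ 2) := by
    have hgr : ContDiffOn ℝ 1 (gradient φ) ω := contDiffOn_gradient hωo hφ2
    have hdir : ∀ y ∈ ω, DifferentiableAt ℝ (gradient φ) y := fun y hy =>
      (hgr.contDiffAt (hωo.mem_nhds hy)).differentiableAt one_ne_zero
    have hf2 : ∀ y ∈ ω, DifferentiableAt ℝ (fderiv ℝ φ) y := fun y hy =>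
      ((hφ2.fderiv_of_isOpen hωo (m := 1) (by norm_num)).contDiffAt
        (hωo.mem_nhds hy)).differentiableAt one_ne_zero
    have hunit : ContDiffOn ℝ 1 (fun x => (√(1 + ‖gradient φ x‖ ^ 2))⁻¹ • gradient φ x) ω := by
      refine ContDiffOn.smul (ContDiffOn.inv (ContDiffOn.sqrt ?_ fun y _ => ?_) fun y _ => ?_) hgr
      · exact contDiffOn_const.add (hgr.norm_sq ℝ)
      · positivity
      · positivity
    -- Built from `G` rather than `gradient φ`, so that it is continuous up to the boundary and
    -- tangential there.
    set V : EuclideanSpace ℝ (Fin n) → EuclideanSpace ℝ (Fin n) :=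
      fun x => φ x • ((√(1 + ‖G x‖ ^ 2))⁻¹ • G x) with hV
    have hVeq : EqOn V (fun x => φ x • ((√(1 + ‖gradient φ x‖ ^ 2))⁻¹ • gradient φ x)) ω :=
      fun y hy => by simp only [hV, hGφ y hy]
    have hdivV : ∀ y ∈ ω, divergence V y =
        φ y * curvatureTerm (gradient φ y) (hessian φ y) +
          ‖gradient φ y‖ ^ 2 / √(1 + ‖gradient φ y‖ ^ 2) := by
      intro y hy
      have h1 : divergence V y = divergence
          (fun x => φ x • ((√(1 + ‖gradient φ x‖ ^ 2))⁻¹ • gradient φ x)) y := by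
        have := (hVeq.eventuallyEq_of_mem (hωo.mem_nhds hy)).fderiv_eq (𝕜 := ℝ)
        simp only [divergence, partialDeriv, this]
      rw [h1, divergence_smul ((hφ1.contDiffAt (hωo.mem_nhds hy)).differentiableAt one_ne_zero)
        ((hunit.contDiffAt (hωo.mem_nhds hy)).differentiableAt one_ne_zero),
        divergence_inv_sqrt_smul (hf2 y hy) (hdir y hy), map_smul, ← inner_gradient_left,
        real_inner_self_eq_norm_sq, smul_eq_mul, div_eq_inv_mul]
    have hdiv0 : ∫ y in ω, divergence V y = 0 := by
      refine hω.setIntegral_divergence_eq_zero ?_ ((hφ1.smul hunit).congr hVeq)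
        ((hφD.add hQ).congr_fun (fun y hy => (hdivV y hy).symm) hωm) fun p hp g hg => ?_
      · fun_prop
      · obtain ⟨U, hU, hpU, hgU, hg'⟩ := hg
        have h := horth.inner_gradient_eq_zero hωo hφ1 hφc hpos hG hGφ hp (g := g)
          ⟨U, hU, hpU, hgU.of_le (by exact_mod_cast le_top), hg'⟩
        simp only [hV, inner_smul_right, h, mul_zero]
    rw [setIntegral_congr_fun hωm hdivV, integral_add hφD hQ] at hdiv0
    linarith
  -- pull-back to `ω`
  set h : EuclideanSpace ℝ (Fin n) → ℝ := fun y =>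
    (√(1 + ‖G y‖ ^ 2))⁻¹ * (-(1 / (n : ℝ)) * (φ y * curvatureTerm (G y) (H y))) with hh
  have hhc : ContinuousOn h (closure ω) := hWc.mul (continuousOn_const.mul (hφc.mul hDc))
  have hhm : AEStronglyMeasurable h (volume.restrict ω) := (hintK hhc).aestronglyMeasurable
  have hgm := measurableSet_graph hωo hφ1.continuousOn
  have hint : ∀ x ∈ graph ω φ, graphMeanCurvature ω φ x *
      ⟪height x • eLast, graphNormal ω φ x⟫ = h (base x) := by
    intro x hx
    rw [graphMeanCurvature, graphNormal_eq hωo hφ1 hposω hG hGφ (subset_closure hx),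
      hGφ _ hx.1, meanCurvature_graphMap hωo hφ2 hx.1, hx.2]
    simp only [hh, hGφ _ hx.1, hHφ _ hx.1, slopeNormal, inner_eq_base_add_height, base_smul, base_eLast, smul_zero,
      inner_zero_left, height_smul, height_sub, height_eLast, height_horizontal]
    ring
  have hWh : ∀ y ∈ ω, √(1 + ‖gradient φ y‖ ^ 2) * h y =
      -(1 / (n : ℝ)) * (φ y * curvatureTerm (gradient φ y) (hessian φ y)) := by
    intro y hy
    simp only [hh, ← hGφ y hy, ← hHφ y hy]
    rw [mul_inv_cancel_left₀ (hW0 y)]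
  refine ⟨?_, hQ, ?_⟩
  · refine IntegrableOn.congr_fun ?_ (fun x hx => (hint x hx).symm) hgm
    rw [integrableOn_graph_comp_base_iff hωo hφ1 hhm]
    exact IntegrableOn.congr_fun (hφD.const_mul _) (fun y hy => (hWh y hy).symm) hωm
  · rw [setIntegral_congr_fun hgm hint, setIntegral_graph_comp_base hωo hφ1 hhm,
      setIntegral_congr_fun hωm hWh, integral_const_mul, hparts]
    ring
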